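/- Let $n\ge 0$ and embed the torus $(\mathbb{C}^*)^{n+1}$ in $\mathbb{P}^{n+1}$ by $x\mapsto(x_0:\cdots:x_n:1)$. For a hypersurface $Z\subset(\mathbb{C}^*)^{n+1}$ the variety of critical points $\mathfrak{X}(Z)\subseteq\mathbb{P}^{n+1}\times\mathbb{P}^n$ is the Zariski closure of the set of pairs $(x,w)\in Z_{\mathrm{reg}}\times\mathbb{P}^n$ such that $x$ is a critical point of the restriction to $Z_{\mathrm{reg}}$ of the $1$-form $\sum_{i=0}^n w_i\,\frac{dx_i}{x_i}$. (1) Let $g\in\mathbb{C}[x_0,\dots,x_n]$ be squarefree and non-constant, and let $Z=V(g)\subset(\mathbb{C}^*)^{n+1}$. Then $\mathfrak{X}(Z)$ coincides with the closure $\Gamma_Z\subseteq\mathbb{P}^{n+1}\times\mathbb{P}^n$ of the graph of the logarithmic Gauss map $\gamma_Z\colon Z\dashrightarrow\mathbb{P}^n$, $x\mapsto(x_0g_{x_0}(x):\cdots:x_ng_{x_n}(x))$. (2) Let $f\in\mathbb{C}[x_0,\dots,x_n]$ be a nonzero homogeneous polynomial of degree $k\ge1$, and let $Z=V(f-1)\subset(\mathbb{C}^*)^{n+1}$.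 Then $\mathfrak{X}(Z)$ coincides with the closure of the graph of the logarithmic Gauss map of $Z$ (taken with $g=f-1$), and its class is $$[\mathfrak{X}(Z)]=\sum_{i=0}^n k\,d_i\,[\mathbb{P}^{n-i}\times\mathbb{P}^i]\in A_*(\mathbb{P}^{n+1}\times\mathbb{P}^n),$$ where $d_0,\dots,d_n$ are the multidegrees of the toric polar map $T_f\colon\mathbb{P}^n\dashrightarrow\mathbb{P}^n$, $x\mapsto(x_0f_{x_0}(x):\cdots:x_nf_{x_n}(x))$, that is, the integers for which the closure $\Gamma_{T_f}$ of its graph has class $[\Gamma_{T_f}]=\sum_{i=0}^n d_i\,[\mathbb{P}^{n-i}\times\mathbb{P}^i]$ in $A_n(\mathbb{P}^n\times\mathbb{P}^n)$. -/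

import Mathlib

open MvPolynomial

noncomputable section

namespace ToricPolar

/-! ### Closed subsets of `ℙᵃ × ℙᵇ` over `ℂ` -/

/-- The set of closed points of `ℙᵃ × ℙᵇ` over the complex numbers. -/
abbrev BiProj (a b : ℕ) : Type :=
  Projectivization ℂ (Fin (a + 1) → ℂ) × Projectivization ℂ (Fin (b + 1) → ℂ)

/-- The bihomogeneous coordinate ring `ℂ[x₀, …, xₐ, y₀, …, y_b]` of `ℙᵃ × ℙᵇ`. -/
abbrev BiRing (a b : ℕ) : Type := MvPolynomial (Fin (a + 1) ⊕ Fin (b + 1)) ℂ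

/-- The bigrading: `bigrading a b (d, e)` consists of the polynomials that are homogeneous of
degree `d` in the `x`-variables and homogeneous of degree `e` in the `y`-variables. -/
def bigrading (a b : ℕ) : ℕ × ℕ → Submodule ℂ (BiRing a b) :=
  weightedHomogeneousSubmodule ℂ
    (Sum.elim (fun _ : Fin (a + 1) => ((1, 0) : ℕ × ℕ)) (fun _ : Fin (b + 1) => ((0, 1) : ℕ × ℕ)))

instance bigradingGradedAlgebra (a b : ℕ) : GradedAlgebra (bigrading a b) :=
  weightedGradedAlgebra ℂ _

/-- The bihomogeneous polynomial `F` vanishes at the point `p` of `ℙᵃ × ℙᵇ`. -/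
def Vanishes {a b : ℕ} (F : BiRing a b) (p : BiProj a b) : Prop :=
  eval (Sum.elim p.1.rep p.2.rep) F = 0

/-- The closure of a subset of `ℙᵃ × ℙᵇ` in the Zariski topology. -/
def zariskiClosure {a b : ℕ} (S : Set (BiProj a b)) : Set (BiProj a b) :=
  {p | ∀ (d : ℕ × ℕ) (F : BiRing a b), F ∈ bigrading a b d →
    (∀ q ∈ S, Vanishes F q) → Vanishes F p}

/-- The ideal generated by the bihomogeneous polynomials that vanish on `S`. -/
def biVanishingIdeal {a b : ℕ} (S : Set (BiProj a b)) : Ideal (BiRing a b) :=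
  Ideal.span {F | (∃ d, F ∈ bigrading a b d) ∧ ∀ q ∈ S, Vanishes F q}

/-! ### Subvarieties, cycles and rational equivalence on `ℙᵃ × ℙᵇ` -/

/-- A subvariety (integral closed subscheme) of `ℙᵃ × ℙᵇ`, given by its ideal: a bihomogeneous
prime ideal that contains neither all `x`-variables nor all `y`-variables. -/
@[ext]
structure Subvariety (a b : ℕ) where
  /-- the bihomogeneous prime ideal -/
  ideal : Ideal (BiRing a b)
  isPrime : ideal.IsPrime
  isHomogeneous : ideal.IsHomogeneous (bigrading a b)
  exists_left : ∃ i : Fin (a + 1), (X (Sum.inl i) : BiRing a b) ∉ ideal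
  exists_right : ∃ j : Fin (b + 1), (X (Sum.inr j) : BiRing a b) ∉ ideal

instance {a b : ℕ} (V : Subvariety a b) : V.ideal.IsPrime := V.isPrime

/-- Algebraic cycles on `ℙᵃ × ℙᵇ`: finite formal `ℤ`-combinations of subvarieties. -/
abbrev Cycle (a b : ℕ) : Type := Subvariety a b →₀ ℤ

/-- `V ⊂ W` has codimension one: `V ≠ W` and no subvariety lies strictly in between. -/
def IsPrimeDivisor {a b : ℕ} (W V : Subvariety a b) : Prop :=
  W.ideal < V.ideal ∧
    ∀ U : Subvariety a b, W.ideal ≤ U.ideal → U.ideal ≤ V.ideal → U = W ∨ U = V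

/-- The local ring of `ℙᵃ × ℙᵇ` along the subvariety `V`: fractions `F / H` of bihomogeneous
polynomials of the same bidegree with `H ∉ I(V)`. -/
abbrev AmbientLocalRing {a b : ℕ} (V : Subvariety a b) : Type :=
  HomogeneousLocalization.AtPrime (bigrading a b) V.ideal

/-- The ideal of the subvariety `W` in the local ring of `ℙᵃ × ℙᵇ` along `V`. -/
def localIdeal {a b : ℕ} (W V : Subvariety a b) : Ideal (AmbientLocalRing V) :=
  (W.ideal.map (algebraMap (BiRing a b) (Localization.AtPrime V.ideal))).comap
    (algebraMap (AmbientLocalRing V) (Localization.AtPrime V.ideal))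

/-- The local ring `𝒪_{W,V}` of the variety `W` along its subvariety `V`. -/
abbrev LocalRingAlong {a b : ℕ} (W V : Subvariety a b) : Type :=
  AmbientLocalRing V ⧸ localIdeal W V

/-- The variable `xᵢ` has bidegree `(1, 0)`. -/
theorem X_inl_mem (a b : ℕ) (i : Fin (a + 1)) :
    (X (Sum.inl i) : BiRing a b) ∈ bigrading a b (1, 0) :=
  isWeightedHomogeneous_X ℂ _ (Sum.inl i)

/-- The variable `yⱼ` has bidegree `(0, 1)`. -/
theorem X_inr_mem (a b : ℕ) (j : Fin (b + 1)) :
    (X (Sum.inr j) : BiRing a b) ∈ bigrading a b (0, 1) :=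
  isWeightedHomogeneous_X ℂ _ (Sum.inr j)

/-- The monomial `xᵢ ^ d * yⱼ ^ e`, where `xᵢ ≠ 0`, `yⱼ ≠ 0` is a standard affine chart that
meets `V`. -/
def chartMonomial {a b : ℕ} (V : Subvariety a b) (d : ℕ × ℕ) : BiRing a b :=
  X (Sum.inl V.exists_left.choose) ^ d.1 * X (Sum.inr V.exists_right.choose) ^ d.2

theorem chartMonomial_mem {a b : ℕ} (V : Subvariety a b) (d : ℕ × ℕ) :
    chartMonomial V d ∈ bigrading a b d := by
  have h := SetLike.mul_mem_graded
    (SetLike.pow_mem_graded d.1 (X_inl_mem a b V.exists_left.choose))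
    (SetLike.pow_mem_graded d.2 (X_inr_mem a b V.exists_right.choose))
  have e : d.1 • ((1, 0) : ℕ × ℕ) + d.2 • ((0, 1) : ℕ × ℕ) = d := by
    ext <;> simp
  rw [e] at h
  exact h

theorem chartMonomial_not_mem {a b : ℕ} (V : Subvariety a b) (d : ℕ × ℕ) :
    chartMonomial V d ∉ V.ideal := by
  intro h
  rcases V.isPrime.mem_or_mem h with h | h
  · exact V.exists_left.choose_spec (V.isPrime.mem_of_pow_mem _ h)
  · exact V.exists_right.choose_spec (V.isPrime.mem_of_pow_mem _ h)

/-- The local equation along `V` of the hypersurface `F = 0`, as a germ on the variety `W`: the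
dehomogenization of `F` in a standard affine chart that meets `V`. -/
def localEquation {a b : ℕ} (W V : Subvariety a b) {d : ℕ × ℕ} {F : BiRing a b}
    (hF : F ∈ bigrading a b d) : LocalRingAlong W V :=
  Ideal.Quotient.mk (localIdeal W V)
    (HomogeneousLocalization.mk
      { deg := d
        num := ⟨F, hF⟩
        den := ⟨chartMonomial V d, chartMonomial_mem V d⟩
        den_mem := chartMonomial_not_mem V d })

/-- The order of vanishing along `V` of the nonzero rational function `F / G` on `W`, where `F` and
`G` are bihomogeneous of the same bidegree and do not vanish identically on `W`. It is
`length (𝒪_{W,V} / (f)) - length (𝒪_{W,V} / (g))` for local equations `f`, `g` of `F`, `G`. -/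
def ordAlong {a b : ℕ} (W V : Subvariety a b) {d : ℕ × ℕ} {F G : BiRing a b}
    (hF : F ∈ bigrading a b d) (hG : G ∈ bigrading a b d) : ℤ :=
  ((Ring.ord (LocalRingAlong W V) (localEquation W V hF)).toNat : ℤ) -
    ((Ring.ord (LocalRingAlong W V) (localEquation W V hG)).toNat : ℤ)

open Classical in
/-- The cycle `c` is the divisor of a nonzero rational function on some subvariety `W`. -/
def IsPrincipalCycle {a b : ℕ} (c : Cycle a b) : Prop :=
  ∃ (W : Subvariety a b) (d : ℕ × ℕ) (F G : BiRing a b)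
    (hF : F ∈ bigrading a b d) (hG : G ∈ bigrading a b d),
    F ∉ W.ideal ∧ G ∉ W.ideal ∧
      ∀ V : Subvariety a b, c V = if IsPrimeDivisor W V then ordAlong W V hF hG else 0

/-- The group of cycles rationally equivalent to zero. -/
def rationallyTrivial (a b : ℕ) : AddSubgroup (Cycle a b) :=
  AddSubgroup.closure {c | IsPrincipalCycle c}

/-- The Chow group `A_*(ℙᵃ × ℙᵇ)`: cycles modulo rational equivalence. -/
abbrev Chow (a b : ℕ) : Type := Cycle a b ⧸ rationallyTrivial a b

/-- The irreducible components of a Zariski closed subset `S`. -/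
def components {a b : ℕ} (S : Set (BiProj a b)) : Set (Subvariety a b) :=
  {V | V.ideal ∈ (biVanishingIdeal S).minimalPrimes}

theorem components_finite {a b : ℕ} (S : Set (BiProj a b)) : (components S).Finite :=
  Set.Finite.preimage (f := Subvariety.ideal)
    (fun _ _ _ _ h => Subvariety.ext h)
    (Ideal.finite_minimalPrimes_of_isNoetherianRing _ (biVanishingIdeal S))

/-- The class in the Chow group of a Zariski closed subset of `ℙᵃ × ℙᵇ` with its reduced structure:
the sum of its irreducible components. -/
def chowClass {a b : ℕ} (S : Set (BiProj a b)) : Chow a b :=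
  QuotientAddGroup.mk (∑ V ∈ (components_finite S).toFinset, Finsupp.single V (1 : ℤ))

/-- The product `ℙⁱ × ℙʲ ⊆ ℙᵃ × ℙᵇ` of linear subspaces, cut out by the vanishing of the
coordinates `x_l` with `l > i` and `y_l` with `l > j`. -/
def linearProduct (a b i j : ℕ) : Set (BiProj a b) :=
  {p | (∀ l : Fin (a + 1), i < (l : ℕ) → p.1.rep l = 0) ∧
    (∀ l : Fin (b + 1), j < (l : ℕ) → p.2.rep l = 0)}

/-! ### Rational maps, multidegrees and the toric polar map -/

/-- The closure of the graph of the rational map `(q₀ : ⋯ : q_b) : ℙᵃ ⇢ ℙᵇ` given by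
homogeneous polynomials of the same degree. -/
def graphClosure {a b : ℕ} (q : Fin (b + 1) → MvPolynomial (Fin (a + 1)) ℂ) :
    Set (BiProj a b) :=
  zariskiClosure
    {p | ∃ (v : Fin (a + 1) → ℂ) (hv : v ≠ 0) (hq : (fun i => eval v (q i)) ≠ 0),
      p = (Projectivization.mk ℂ v hv, Projectivization.mk ℂ (fun i => eval v (q i)) hq)}

/-- The integers `d₀, …, dₙ` are the multidegrees of the rational map `(q₀ : ⋯ : qₙ)` from `ℙⁿ`
to `ℙⁿ`: the graph has the class `∑ dᵢ [ℙⁿ⁻ⁱ × ℙⁱ]`, that is, `∑ dᵢ hⁱ kⁿ⁻ⁱ` with `h`, `k` the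
hyperplane classes of the first and of the second factor. -/
def IsMultidegrees {n : ℕ} (q : Fin (n + 1) → MvPolynomial (Fin (n + 1)) ℂ)
    (d : Fin (n + 1) → ℤ) : Prop :=
  chowClass (graphClosure q) =
    ∑ i : Fin (n + 1), d i • chowClass (linearProduct n n (n - (i : ℕ)) (i : ℕ))

/-- The components `xᵢ ∂g/∂xᵢ`. For `g` homogeneous they define the toric polar map of `g`. -/
def logGradient {n : ℕ} (g : MvPolynomial (Fin (n + 1)) ℂ) (i : Fin (n + 1)) :
    MvPolynomial (Fin (n + 1)) ℂ :=
  X i * pderiv i g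

/-! ### Hypersurfaces of the torus, logarithmic Gauss map, variety of critical points -/

/-- The zero locus of `g` in the torus `(ℂ^*)ⁿ⁺¹`. -/
def torusZeros {n : ℕ} (g : MvPolynomial (Fin (n + 1)) ℂ) : Set (Fin (n + 1) → ℂ) :=
  {x | (∀ i, x i ≠ 0) ∧ eval x g = 0}

/-- The point `(x₀ : ⋯ : xₙ : 1)` of `ℙⁿ⁺¹`. -/
def affinePoint {n : ℕ} (x : Fin (n + 1) → ℂ) : Projectivization ℂ (Fin (n + 1 + 1) → ℂ) :=
  Projectivization.mk ℂ (Fin.snoc x 1 : Fin (n + 1 + 1) → ℂ)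
    (fun h => one_ne_zero (α := ℂ) (by simpa using congrFun h (Fin.last (n + 1))))

/-- The closure in `ℙⁿ⁺¹ × ℙⁿ` of the graph of the logarithmic Gauss map
`x ↦ (x₀ ∂g/∂x₀ : ⋯ : xₙ ∂g/∂xₙ)` of the hypersurface `g = 0` of the torus. -/
def logGaussGraph {n : ℕ} (g : MvPolynomial (Fin (n + 1)) ℂ) : Set (BiProj (n + 1) n) :=
  zariskiClosure
    {p | ∃ x ∈ torusZeros g, ∃ h : (fun i => eval x (logGradient g i)) ≠ 0,
      p = (affinePoint x, Projectivization.mk ℂ (fun i => eval x (logGradient g i)) h)}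

/-- The Zariski tangent space at `x` of a subset `Z` of the torus: the common kernel of the
differentials at `x` of all polynomials that vanish on `Z`. -/
def tangentSpace {n : ℕ} (Z : Set (Fin (n + 1) → ℂ)) (x : Fin (n + 1) → ℂ) :
    Submodule ℂ (Fin (n + 1) → ℂ) where
  carrier := {v | ∀ h : MvPolynomial (Fin (n + 1)) ℂ, (∀ z ∈ Z, eval z h = 0) →
    ∑ i, eval x (pderiv i h) * v i = 0}
  add_mem' := by
    intro v w hv hw h hh
    simp only [Pi.add_apply, mul_add, Finset.sum_add_distrib, hv h hh, hw h hh, add_zero]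
  zero_mem' := by
    intro h _
    simp
  smul_mem' := by
    intro c v hv h hh
    have e : ∀ i, eval x (pderiv i h) * (c • v) i = c * (eval x (pderiv i h) * v i) := by
      intro i
      simp only [Pi.smul_apply, smul_eq_mul]
      ring
    simp only [e, ← Finset.mul_sum, hv h hh, mul_zero]

/-- The regular points of a hypersurface `Z` of the torus `(ℂ^*)ⁿ⁺¹`, which has dimension `n` at
each of its points. -/
def regularPoints {n : ℕ} (Z : Set (Fin (n + 1) → ℂ)) : Set (Fin (n + 1) → ℂ) :=
  {x | x ∈ Z ∧ Module.finrank ℂ (tangentSpace Z x) = n}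

/-- `x` is a critical point of the restriction to `Z` of the `1`-form `∑ wᵢ dxᵢ / xᵢ`: the form
vanishes on the tangent space of `Z` at `x`. -/
def IsCriticalPoint {n : ℕ} (Z : Set (Fin (n + 1) → ℂ)) (x w : Fin (n + 1) → ℂ) : Prop :=
  ∀ v ∈ tangentSpace Z x, ∑ i, w i * (v i / x i) = 0

/-- The variety of critical points of a hypersurface `Z` of the torus `(ℂ^*)ⁿ⁺¹`: the closure in
`ℙⁿ⁺¹ × ℙⁿ` of the set of pairs `(x, w)` with `x` a regular point of `Z` that is a critical point
of the restriction of `∑ wᵢ dxᵢ / xᵢ` to the regular part of `Z`. -/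
def criticalVariety {n : ℕ} (Z : Set (Fin (n + 1) → ℂ)) : Set (BiProj (n + 1) n) :=
  zariskiClosure
    {p | ∃ x ∈ regularPoints Z, p.1 = affinePoint x ∧ IsCriticalPoint Z x p.2.rep}

end ToricPolar

end

open ToricPolar

/-!
# The variety of critical points and the toric polar map

For a squarefree equation `g` the Nullstellensatz shows that every polynomial `h` vanishing on
`Z = V(g)` satisfies `(∏ xᵢ) h ∈ (g)`, so the tangent space of `Z` at a point `x` of the torus is
the kernel of the differential of `g`. Hence `x` is regular exactly if the logarithmic gradient of
`g` does not vanish at `x`, and then the critical forms at `x` are its multiples: the closures of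
the two sets of pairs agree because the sets do (`criticalVariety_eq_logGaussGraph`). If `f` is
homogeneous, then `f - 1` is squarefree by Euler's identity (`squarefree_sub_one`).

For the class, let `Γ ⊆ ℙⁿ × ℙⁿ` be the graph of the toric polar map of `f`, and let `z` be the last
coordinate of `ℙⁿ⁺¹`. By homogeneity the logarithmic Gauss map of `f = 1` factors through the toric
polar map, so that its graph lies in the cone over `Γ` with vertex `(0 : ⋯ : 0 : 1)`. More
precisely, its ideal is generated by the ideal of the cone and `z ^ k - f`
(`biVanishingIdeal_logGaussGraph`): after division by this monic polynomial in `z`, a remainder of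
degree less than `k` has to vanish at the `k` distinct roots of `z ^ k = f(x)` over the general
point `x`. On the cone, the rational function `(z ^ k - f) / z ^ k` has a simple zero along every
component of the graph, a pole of order `k` along the copy of `Γ` in the hyperplane `z = 0`, and no
other zeros and poles (`isPrincipalCycle_sub`). The zeros are simple because `z ^ k - f` is
separable over the function field of `Γ`. A prime divisor on which `z ^ k - f` vanishes dominates
`Γ`, as otherwise the cone over its projection would lie strictly between it and the cone over `Γ`.

So the class of the graph is `k` times the push-forward of the class of `Γ` along the inclusion
`ℙⁿ × ℙⁿ ⊂ ℙⁿ⁺¹ × ℙⁿ` of the hyperplane `z = 0`. This push-forward is well defined on Chow groups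
(`embedChow`), since a subvariety of the hyperplane has the same local rings in both ambient spaces,
and it maps `[ℙⁱ × ℙʲ]` to `[ℙⁱ × ℙʲ]`.
-/

/-! ### Primes of a polynomial ring over the generic point of the base -/

namespace Polynomial

section GenericFiber

variable {A : Type*} [CommRing A] [IsDomain A]

theorem disjoint_map_C_nonZeroDivisors {V : Ideal A[X]} (hV : V.comap C = ⊥) :
    Disjoint ((Submonoid.map C (nonZeroDivisors A) : Submonoid A[X]) : Set A[X])
      (V : Set A[X]) := by
  rw [Set.disjoint_left]
  rintro _ ⟨a, ha, rfl⟩ h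
  have : a ∈ V.comap C := h
  rw [hV, Ideal.mem_bot] at this
  exact nonZeroDivisors.ne_zero ha this

attribute [local instance] Polynomial.algebra Polynomial.isLocalization in
/-- The primes of `A[X]` that lie over the zero ideal of the domain `A` are the primes of `K[X]`
with `K` the fraction field, so there is no inclusion between two nonzero ones. -/
theorem eq_of_le_of_comap_C_eq_bot {U V : Ideal A[X]} [hU : U.IsPrime] [hV : V.IsPrime]
    (hUV : U ≤ V) (hne : U ≠ ⊥) (hbot : V.comap C = ⊥) : U = V := by
  let M := Submonoid.map C (nonZeroDivisors A)
  have hdV : Disjoint (M : Set A[X]) V := disjoint_map_C_nonZeroDivisors hbot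
  have hdU : Disjoint (M : Set A[X]) U := hdV.mono_right hUV
  have hpU := IsLocalization.isPrime_of_isPrime_disjoint M (FractionRing A)[X] U hU hdU
  have hpV := IsLocalization.isPrime_of_isPrime_disjoint M (FractionRing A)[X] V hV hdV
  have hcU := IsLocalization.under_map_of_isPrime_disjoint M (FractionRing A)[X] hU hdU
  have hcV := IsLocalization.under_map_of_isPrime_disjoint M (FractionRing A)[X] hV hdV
  have hUne : U.map (algebraMap A[X] (FractionRing A)[X]) ≠ ⊥ := by
    obtain ⟨p, hp, hp0⟩ := Submodule.exists_mem_ne_zero_of_ne_bot hne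
    intro h
    have h1 := Ideal.mem_map_of_mem (algebraMap A[X] (FractionRing A)[X]) hp
    rw [h, Ideal.mem_bot, Polynomial.algebraMap_def, coe_mapRingHom] at h1
    exact hp0 ((Polynomial.map_eq_zero_iff (IsFractionRing.injective A (FractionRing A))).1 h1)
  have hmax : (U.map (algebraMap A[X] (FractionRing A)[X])).IsMaximal :=
    hpU.isMaximal hUne
  rw [← hcU, ← hcV, hmax.eq_of_le hpV.ne_top (Ideal.map_mono hUV)]

attribute [local instance] Polynomial.algebra Polynomial.isLocalization in
/-- Over the fraction field of `A` the separable polynomial `F` is a product of distinct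
irreducible factors, so it generates the prime `V` up to elements outside of `V`. -/
theorem exists_dvd_mul_of_separable {V : Ideal A[X]} [hV : V.IsPrime]
    (hbot : V.comap C = ⊥) {F : A[X]} (hF : F ∈ V)
    (hsep : (F.map (algebraMap A (FractionRing A))).Separable) {h : A[X]} (hh : h ∈ V) :
    ∃ s ∉ V, F ∣ s * h := by
  let K := FractionRing A
  let M := Submonoid.map C (nonZeroDivisors A)
  have hinj : Function.Injective (algebraMap A[X] K[X]) :=
    Polynomial.map_injective _ (IsFractionRing.injective A K)
  have hdV : Disjoint (M : Set A[X]) V := disjoint_map_C_nonZeroDivisors hbot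
  have hcV := IsLocalization.under_map_of_isPrime_disjoint M K[X] hV hdV
  have hpV := IsLocalization.isPrime_of_isPrime_disjoint M K[X] V hV hdV
  have hmem : ∀ p : A[X], algebraMap A[X] K[X] p ∈ V.map (algebraMap A[X] K[X]) ↔ p ∈ V := by
    intro p
    conv_rhs => rw [← hcV]
    rfl
  obtain ⟨q, hq⟩ := (IsPrincipalIdealRing.principal (V.map (algebraMap A[X] K[X]))).principal
  have hq' : ∀ p : A[X], p ∈ V ↔ q ∣ algebraMap A[X] K[X] p := by
    intro p
    rw [← hmem, hq, Ideal.submodule_span_eq, Ideal.mem_span_singleton]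
  obtain ⟨ρ, hρ⟩ := (hq' F).1 hF
  obtain ⟨σ, hσ⟩ := (hq' h).1 hh
  have hqρ : ¬ q ∣ ρ := by
    rintro ⟨τ, rfl⟩
    have hsq : Squarefree (algebraMap A[X] K[X] F) := hsep.squarefree
    have hu := hsq q ⟨τ, by rw [hρ]; ring⟩
    apply hpV.ne_top
    rw [hq, Ideal.submodule_span_eq]
    exact Ideal.span_singleton_eq_top.2 hu
  obtain ⟨⟨ρ', a⟩, ha⟩ := IsLocalization.surj M ρ
  obtain ⟨⟨σ', b⟩, hb⟩ := IsLocalization.surj M σ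
  dsimp only at ha hb
  have hunit : ∀ m : M, IsUnit (algebraMap A[X] K[X] m) := IsLocalization.map_units K[X]
  refine ⟨b * ρ', ?_, a * σ', ?_⟩
  · rw [hq', map_mul, ← ha, (hunit b).dvd_mul_left, (hunit a).dvd_mul_right]
    exact hqρ
  · apply hinj
    simp only [map_mul, hρ, hσ, ← ha, ← hb]
    ring

variable {k : ℕ} {a : A}

theorem separable_map_X_pow_sub_C [CharZero A] (hk : k ≠ 0) (ha : a ≠ 0) :
    ((X ^ k - C a : A[X]).map (algebraMap A (FractionRing A))).Separable := by
  have : CharZero (FractionRing A) :=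
    charZero_of_injective_algebraMap (IsFractionRing.injective A (FractionRing A))
  simp only [Polynomial.map_sub, Polynomial.map_pow, map_X, map_C]
  exact separable_X_pow_sub_C _ (by exact_mod_cast hk)
    (by simpa using ha)

theorem Monic.dvd_of_dvd_C_mul {F p : A[X]} (hF : F.Monic) (ha : a ≠ 0) (h : F ∣ C a * p) :
    F ∣ p := by
  rw [← modByMonic_eq_zero_iff_dvd hF] at h ⊢
  rw [← smul_eq_C_mul, smul_modByMonic] at h
  exact (smul_eq_zero.1 h).resolve_left ha

/-- The quotient of `A[X]` by a monic polynomial is torsion free over `A`, so its minimal primes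
lie over zero. -/
theorem Monic.comap_C_eq_bot_of_mem_minimalPrimes {F : A[X]} (hF : F.Monic) {V : Ideal A[X]}
    (hV : V ∈ (Ideal.span {F}).minimalPrimes) : V.comap C = ⊥ := by
  rw [eq_bot_iff]
  intro c hc
  by_contra hne
  obtain ⟨y, hy, hxy⟩ := Ideal.exists_mul_mem_of_mem_minimalPrimes hV hc
  rw [Ideal.mem_span_singleton] at hy hxy
  exact hy (hF.dvd_of_dvd_C_mul hne hxy)

theorem mem_minimalPrimes_span_singleton_iff {F : A[X]} (hF : F.Monic) {V : Ideal A[X]}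
    [hV : V.IsPrime] :
    V ∈ (Ideal.span {F}).minimalPrimes ↔ V.comap C = ⊥ ∧ F ∈ V := by
  refine ⟨fun h => ⟨hF.comap_C_eq_bot_of_mem_minimalPrimes h,
    h.le (Ideal.mem_span_singleton_self F)⟩, fun ⟨hbot, hFV⟩ => ⟨⟨hV, ?_⟩, ?_⟩⟩
  · rwa [Ideal.span_singleton_le_iff_mem]
  · rintro U ⟨hU, hFU⟩ hUV
    refine (eq_of_le_of_comap_C_eq_bot hUV ?_ hbot).ge
    rintro rfl
    exact hF.ne_zero ((Ideal.mem_bot).1 (hFU (Ideal.mem_span_singleton_self F)))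

end GenericFiber

end Polynomial

noncomputable section

namespace ToricPolar

/-! ### The variety of critical points and the logarithmic Gauss map -/

section CriticalPoints

variable {n : ℕ}

/-- By the Nullstellensatz, a polynomial that vanishes on a squarefree hypersurface of the torus
becomes divisible by the equation after multiplication by the product of the coordinates. -/
theorem dvd_prod_X_mul_of_vanishes {g : MvPolynomial (Fin (n + 1)) ℂ} (hg : Squarefree g)
    {h : MvPolynomial (Fin (n + 1)) ℂ} (hh : ∀ z ∈ torusZeros g, eval z h = 0) :
    g ∣ (∏ i, X i) * h := by
  have hrad : (Ideal.span {g}).IsRadical := isRadical_iff_span_singleton.1 hg.isRadical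
  rw [← Ideal.mem_span_singleton, ← hrad.radical,
    ← vanishingIdeal_zeroLocus_eq_radical (K := ℂ), mem_vanishingIdeal_iff]
  intro x hx
  have hgx : eval x g = 0 := hx g (Ideal.mem_span_singleton_self g)
  rw [aeval_eq_eval]
  simp only [map_mul, map_prod, eval_X]
  by_cases hx0 : ∀ i, x i ≠ 0
  · rw [hh x ⟨hx0, hgx⟩, mul_zero]
  · push Not at hx0
    obtain ⟨i, hi⟩ := hx0
    rw [Finset.prod_eq_zero (Finset.mem_univ i) hi, zero_mul]

/-- At a point of a squarefree hypersurface `g = 0`, the Zariski tangent space is the kernel of the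
differential of `g`. -/
theorem mem_tangentSpace_iff {g : MvPolynomial (Fin (n + 1)) ℂ} (hg : Squarefree g)
    {x : Fin (n + 1) → ℂ} (hx : x ∈ torusZeros g) {v : Fin (n + 1) → ℂ} :
    v ∈ tangentSpace (torusZeros g) x ↔ ∑ i, eval x (pderiv i g) * v i = 0 := by
  refine ⟨fun hv => hv g fun z hz => hz.2, fun hv h hh => ?_⟩
  obtain ⟨r, hr⟩ := dvd_prod_X_mul_of_vanishes hg hh
  have hc : (∏ i, x i) ≠ 0 := Finset.prod_ne_zero_iff.2 fun i _ => hx.1 i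
  have hd : ∀ i, (∏ i, x i) * eval x (pderiv i h) = eval x r * eval x (pderiv i g) := by
    intro i
    have := congrArg (fun p => eval x (pderiv i p)) hr
    simpa [Derivation.leibniz, hh x hx, hx.2] using this
  apply mul_left_cancel₀ hc
  rw [mul_zero, Finset.mul_sum]
  calc ∑ i, (∏ i, x i) * (eval x (pderiv i h) * v i)
      = ∑ i, eval x r * (eval x (pderiv i g) * v i) := by
        refine Finset.sum_congr rfl fun i _ => ?_
        rw [← mul_assoc, hd, mul_assoc]
    _ = 0 := by rw [← Finset.mul_sum, hv, mul_zero]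

theorem tangentSpace_eq_ker {g : MvPolynomial (Fin (n + 1)) ℂ} (hg : Squarefree g)
    {x : Fin (n + 1) → ℂ} (hx : x ∈ torusZeros g) :
    tangentSpace (torusZeros g) x =
      LinearMap.ker (dotProductEquiv ℂ (Fin (n + 1)) fun i => eval x (pderiv i g)) := by
  ext v
  rw [mem_tangentSpace_iff hg hx]
  rfl

/-- The regular points of a squarefree hypersurface `g = 0` are the points where the logarithmic
gradient of `g` does not vanish. -/
theorem mem_regularPoints_iff {g : MvPolynomial (Fin (n + 1)) ℂ} (hg : Squarefree g)
    {x : Fin (n + 1) → ℂ} :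
    x ∈ regularPoints (torusZeros g) ↔
      x ∈ torusZeros g ∧ (fun i => eval x (logGradient g i)) ≠ 0 := by
  refine and_congr_right fun hx => ?_
  rw [tangentSpace_eq_ker hg hx]
  set c : Fin (n + 1) → ℂ := fun i => eval x (pderiv i g) with hc
  have hlog : (fun i => eval x (logGradient g i)) ≠ 0 ↔ c ≠ 0 := by
    simp only [ne_eq, funext_iff, Pi.zero_apply, logGradient, map_mul, eval_X, mul_eq_zero,
      hx.1, false_or, hc]
  rw [hlog]
  constructor
  · rintro h h0
    rw [h0, map_zero, LinearMap.ker_zero, finrank_top] at h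
    simp at h
  · intro h
    have h1 : dotProductEquiv ℂ (Fin (n + 1)) c ≠ 0 := by simpa using h
    have h2 := Module.Dual.finrank_ker_add_one_of_ne_zero h1
    simpa using h2

/-- A logarithmic `1`-form `∑ wᵢ dxᵢ / xᵢ` vanishes on the tangent space of the hypersurface at a
regular point exactly if `w` is proportional to the logarithmic gradient. -/
theorem isCriticalPoint_iff {g : MvPolynomial (Fin (n + 1)) ℂ} (hg : Squarefree g)
    {x : Fin (n + 1) → ℂ} (hx : x ∈ torusZeros g)
    (hlog : (fun i => eval x (logGradient g i)) ≠ 0) {w : Fin (n + 1) → ℂ} :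
    IsCriticalPoint (torusZeros g) x w ↔
      ∃ a : ℂ, a • (fun i => eval x (logGradient g i)) = w := by
  have hlogi : ∀ i, eval x (logGradient g i) = x i * eval x (pderiv i g) := fun i => by
    simp [logGradient]
  constructor
  · intro h
    obtain ⟨j, hj⟩ := Function.ne_iff.1 hlog
    rw [Pi.zero_apply, hlogi] at hj
    have hcj : eval x (pderiv j g) ≠ 0 := right_ne_zero_of_mul hj
    refine ⟨w j / (x j * eval x (pderiv j g)), funext fun i => ?_⟩
    -- test the form on a tangent vector supported in the coordinates `i` and `j`
    have ht : eval x (pderiv j g) • Pi.single i (1 : ℂ) - eval x (pderiv i g) • Pi.single j 1 ∈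
        tangentSpace (torusZeros g) x := by
      rw [mem_tangentSpace_iff hg hx]
      simp [mul_sub, Finset.sum_sub_distrib, Pi.single_apply, mul_comm]
    have h1 := h _ ht
    simp only [Pi.sub_apply, Pi.smul_apply, smul_eq_mul, Pi.single_apply, mul_ite, mul_one,
      mul_zero, sub_div, mul_sub, Finset.sum_sub_distrib, ite_div, zero_div, Finset.sum_ite_eq',
      Finset.mem_univ, if_true] at h1
    have hxi := hx.1 i
    have hxj := hx.1 j
    rw [Pi.smul_apply, smul_eq_mul, hlogi]
    field_simp at h1 ⊢
    linear_combination -h1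
  · rintro ⟨a, rfl⟩ v hv
    rw [mem_tangentSpace_iff hg hx] at hv
    calc ∑ i, (a • fun i => eval x (logGradient g i)) i * (v i / x i)
        = ∑ i, a * (eval x (pderiv i g) * v i) := by
          refine Finset.sum_congr rfl fun i _ => ?_
          have hxi := hx.1 i
          rw [Pi.smul_apply, smul_eq_mul, hlogi]
          field_simp
      _ = 0 := by rw [← Finset.mul_sum, hv, mul_zero]

theorem criticalVariety_eq_logGaussGraph {g : MvPolynomial (Fin (n + 1)) ℂ} (hg : Squarefree g) :
    criticalVariety (torusZeros g) = logGaussGraph g := by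
  unfold criticalVariety logGaussGraph
  congr 1
  ext ⟨p, q⟩
  simp only [Set.mem_ofPred_eq, mem_regularPoints_iff hg, Prod.mk.injEq]
  constructor
  · rintro ⟨x, ⟨hx, hlog⟩, rfl, hcrit⟩
    refine ⟨x, hx, hlog, rfl, ?_⟩
    obtain ⟨a, ha⟩ := (isCriticalPoint_iff hg hx hlog).1 hcrit
    conv_lhs => rw [← q.mk_rep]
    exact (Projectivization.mk_eq_mk_iff' ℂ _ _ _ _).2 ⟨a, ha⟩
  · rintro ⟨x, hx, hlog, rfl, rfl⟩
    refine ⟨x, ⟨hx, hlog⟩, rfl, (isCriticalPoint_iff hg hx hlog).2 ?_⟩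
    obtain ⟨a, ha⟩ := Projectivization.exists_smul_eq_mk_rep ℂ _ hlog
    exact ⟨a, ha⟩

end CriticalPoints

section AffineEquation

variable {n k : ℕ} {f : MvPolynomial (Fin (n + 1)) ℂ}

theorem sum_logGradient (hf : f.IsHomogeneous k) :
    ∑ i, logGradient f i = (k : MvPolynomial (Fin (n + 1)) ℂ) * f := by
  simpa [logGradient] using hf.sum_X_mul_pderiv

/-- A multiple factor of `f - 1` divides the partial derivatives, hence `f` by Euler's identity,
hence `1`. -/
theorem squarefree_sub_one (hk : 1 ≤ k) (hf : f.IsHomogeneous k) : Squarefree (f - 1) := by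
  rintro p ⟨q, hq⟩
  have hd : ∀ i, p ∣ pderiv i f := fun i => by
    have h := congrArg (pderiv i) hq
    simp only [map_sub, Derivation.leibniz, smul_eq_mul, pderiv_one, sub_zero] at h
    rw [h]
    exact ⟨p * pderiv i q + q * pderiv i p + q * pderiv i p, by ring⟩
  have h1 : p ∣ (k : MvPolynomial (Fin (n + 1)) ℂ) * f := by
    rw [← sum_logGradient hf]
    exact Finset.dvd_sum fun i _ => Dvd.dvd.mul_left (hd i) _
  have hunit : IsUnit (k : MvPolynomial (Fin (n + 1)) ℂ) := by
    have : (k : ℂ) ≠ 0 := by exact_mod_cast (by omega : k ≠ 0)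
    simpa using (isUnit_iff_ne_zero.2 this).map (C : ℂ →+* MvPolynomial (Fin (n + 1)) ℂ)
  have h2 : p ∣ f := (hunit.dvd_mul_left).1 h1
  have h3 : p ∣ f - 1 := ⟨p * q, by rw [hq]; ring⟩
  exact isUnit_of_dvd_one (by simpa using dvd_sub h2 h3)

end AffineEquation

/-! ### Bihomogeneous polynomials and vanishing ideals -/

section VanishingIdeals

variable {a b : ℕ}

theorem eval_smul_smul {d : ℕ × ℕ} {F : BiRing a b} (hF : F ∈ bigrading a b d) (s t : ℂ)
    (v : Fin (a + 1) → ℂ) (w : Fin (b + 1) → ℂ) :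
    eval (Sum.elim (s • v) (t • w)) F = s ^ d.1 * t ^ d.2 * eval (Sum.elim v w) F := by
  rw [eval_eq', eval_eq', Finset.mul_sum]
  refine Finset.sum_congr rfl fun m hm => ?_
  have hw := hF (mem_support_iff.1 hm)
  rw [Finsupp.weight_apply, Finsupp.sum_fintype _ _ (by simp), Fintype.sum_sum_type] at hw
  have h1 : ∑ i, m (Sum.inl i) = d.1 := by
    simpa [Prod.fst_sum] using congrArg Prod.fst hw
  have h2 : ∑ i, m (Sum.inr i) = d.2 := by
    simpa [Prod.snd_sum] using congrArg Prod.snd hw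
  simp only [Fintype.prod_sum_type, Sum.elim_inl, Sum.elim_inr, Pi.smul_apply, smul_eq_mul,
    mul_pow, Finset.prod_mul_distrib, Finset.prod_pow_eq_pow_sum, h1, h2]
  ring

theorem vanishes_mk_iff {d : ℕ × ℕ} {F : BiRing a b} (hF : F ∈ bigrading a b d)
    {v : Fin (a + 1) → ℂ} (hv : v ≠ 0) {w : Fin (b + 1) → ℂ} (hw : w ≠ 0) :
    Vanishes F (Projectivization.mk ℂ v hv, Projectivization.mk ℂ w hw) ↔
      eval (Sum.elim v w) F = 0 := by
  obtain ⟨s, hs⟩ := Projectivization.exists_smul_eq_mk_rep ℂ v hv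
  obtain ⟨t, ht⟩ := Projectivization.exists_smul_eq_mk_rep ℂ w hw
  have h := eval_smul_smul hF s t v w
  unfold Vanishes
  dsimp only
  rw [← hs, ← ht, Units.smul_def, Units.smul_def, h]
  simp

/-- A polynomial that vanishes on the torus orbit of `(v, w)` has all its bihomogeneous components
vanishing at `(v, w)`, because distinct characters are linearly independent. -/
theorem eval_decompose_eq_zero {G : BiRing a b} {v : Fin (a + 1) → ℂ} {w : Fin (b + 1) → ℂ}
    (h : ∀ s t : ℂˣ, eval (Sum.elim ((s : ℂ) • v) ((t : ℂ) • w)) G = 0) (d : ℕ × ℕ) :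
    eval (Sum.elim v w) (DirectSum.decompose (bigrading a b) G d : BiRing a b) = 0 := by
  let χ : ℕ × ℕ → (ℂˣ × ℂˣ →* ℂ) := fun d =>
    { toFun := fun p => (p.1 : ℂ) ^ d.1 * (p.2 : ℂ) ^ d.2
      map_one' := by simp
      map_mul' := fun p q => by simp only [Prod.fst_mul, Prod.snd_mul, Units.val_mul]; ring }
  have hχ : Function.Injective χ := by
    intro d e hde
    have h2 : (2 : ℂ) ≠ 0 := two_ne_zero
    have e1 := DFunLike.congr_fun hde (Units.mk0 2 h2, 1)
    have e2 := DFunLike.congr_fun hde (1, Units.mk0 2 h2)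
    simp only [χ, MonoidHom.coe_mk, OneHom.coe_mk, Units.val_mk0, Units.val_one, one_pow, mul_one,
      one_mul] at e1 e2
    norm_cast at e1 e2
    exact Prod.ext (Nat.pow_right_injective le_rfl e1) (Nat.pow_right_injective le_rfl e2)
  have hli := (linearIndependent_monoidHom (ℂˣ × ℂˣ) ℂ).comp χ hχ
  rw [linearIndependent_iff'] at hli
  by_cases hd : d ∈ (DirectSum.decompose (bigrading a b) G).support
  · refine hli (DirectSum.decompose (bigrading a b) G).support
      (fun d => eval (Sum.elim v w) (DirectSum.decompose (bigrading a b) G d : BiRing a b))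
      (funext fun p => ?_) d hd
    rw [Pi.zero_apply, ← h p.1 p.2]
    conv_rhs => rw [← DirectSum.sum_support_decompose (bigrading a b) G]
    rw [map_sum, Finset.sum_apply]
    refine Finset.sum_congr rfl fun e _ => ?_
    rw [eval_smul_smul (SetLike.coe_mem _)]
    simp [χ, mul_comm]
  · rw [DFinsupp.notMem_support_iff.1 hd]
    simp

/-- The vanishing ideal of `S` consists of the polynomials that vanish on the affine bicone
over `S`. -/
theorem mem_biVanishingIdeal_iff {S : Set (BiProj a b)} {G : BiRing a b} :
    G ∈ biVanishingIdeal S ↔ ∀ (v : Fin (a + 1) → ℂ) (hv : v ≠ 0) (w : Fin (b + 1) → ℂ)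
      (hw : w ≠ 0), (Projectivization.mk ℂ v hv, Projectivization.mk ℂ w hw) ∈ S →
        eval (Sum.elim v w) G = 0 := by
  constructor
  · intro hG v hv w hw hS
    have hle : biVanishingIdeal S ≤ RingHom.ker (eval (Sum.elim v w)) := by
      refine Ideal.span_le.2 ?_
      rintro F ⟨⟨d, hd⟩, hF⟩
      exact (vanishes_mk_iff hd hv hw).1 (hF _ hS)
    exact hle hG
  · intro h
    rw [← DirectSum.sum_support_decompose (bigrading a b) G]
    refine Ideal.sum_mem _ fun d _ => Ideal.subset_span ⟨⟨d, SetLike.coe_mem _⟩, fun q hq => ?_⟩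
    refine eval_decompose_eq_zero (fun s t => ?_) d
    have hs : (s : ℂ) • q.1.rep ≠ 0 := smul_ne_zero s.ne_zero q.1.rep_nonzero
    have ht : (t : ℂ) • q.2.rep ≠ 0 := smul_ne_zero t.ne_zero q.2.rep_nonzero
    refine h _ hs _ ht ?_
    convert hq
    · conv_rhs => rw [← q.1.mk_rep]
      exact (Projectivization.mk_eq_mk_iff' ℂ _ _ _ _).2 ⟨s, rfl⟩
    · conv_rhs => rw [← q.2.mk_rep]
      exact (Projectivization.mk_eq_mk_iff' ℂ _ _ _ _).2 ⟨t, rfl⟩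

theorem biVanishingIdeal_zariskiClosure (S : Set (BiProj a b)) :
    biVanishingIdeal (zariskiClosure S) = biVanishingIdeal S := by
  unfold biVanishingIdeal
  congr 1
  ext F
  refine and_congr_right fun ⟨d, hd⟩ => ⟨fun h q hq => ?_, fun h q hq => hq d F hd h⟩
  exact h q fun _ _ _ hG => hG q hq

theorem isHomogeneous_biVanishingIdeal (S : Set (BiProj a b)) :
    (biVanishingIdeal S).IsHomogeneous (bigrading a b) :=
  Ideal.homogeneous_span _ _ fun _ hF => hF.1

end VanishingIdeals

/-! ### Local rings along subvarieties and orders of vanishing -/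

section RingOrd

variable {R S : Type*} [CommRing R] [CommRing S]

theorem ringOrd_ringEquiv (e : R ≃+* S) (x : R) : Ring.ord R x = Ring.ord S (e x) := by
  let q : (R ⧸ Ideal.span {x}) ≃+* (S ⧸ Ideal.span {e x}) :=
    Ideal.quotientEquiv _ _ e (by rw [Ideal.map_span, Set.image_singleton]; rfl)
  have : RingHomSurjective (e : R →+* S) := ⟨e.surjective⟩
  let f : (R ⧸ Ideal.span {x}) →ₛₗ[(e : R →+* S)] (S ⧸ Ideal.span {e x}) :=
    { toFun := q
      map_add' := map_add q
      map_smul' := fun r y => by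
        rw [Algebra.smul_def, map_mul, Algebra.smul_def]
        rfl }
  rw [Ring.ord, Ring.ord, Module.length, Module.length, WithBot.unbot_inj,
    Order.krullDim_eq_of_orderIso (Submodule.orderIsoMapComapOfBijective f q.bijective)]

theorem ringOrd_eq_one {x : R} (h : (Ideal.span {x}).IsMaximal) : Ring.ord R x = 1 := by
  rw [Ring.ord, Module.length_eq_one_iff, isSimpleModule_iff_isCoatom]
  exact h.out

end RingOrd

section LocalRings

variable {a b : ℕ}

/-- The germ along `V` of the rational function `F / s`. -/
def germ (V : Subvariety a b) {d : ℕ × ℕ} {F s : BiRing a b} (hF : F ∈ bigrading a b d)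
    (hs : s ∈ bigrading a b d) (hsV : s ∉ V.ideal) : AmbientLocalRing V :=
  HomogeneousLocalization.mk ⟨d, ⟨F, hF⟩, ⟨s, hs⟩, hsV⟩

theorem exists_eq_germ {V : Subvariety a b} (x : AmbientLocalRing V) :
    ∃ (d : ℕ × ℕ) (F s : BiRing a b) (hF : F ∈ bigrading a b d) (hs : s ∈ bigrading a b d)
      (hsV : s ∉ V.ideal), x = germ V hF hs hsV := by
  obtain ⟨⟨d, F, s, hs⟩, rfl⟩ := HomogeneousLocalization.mk_surjective x
  exact ⟨d, F, s, F.2, s.2, hs, rfl⟩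

theorem val_germ {V : Subvariety a b} {d : ℕ × ℕ} {F s : BiRing a b} (hF : F ∈ bigrading a b d)
    (hs : s ∈ bigrading a b d) (hsV : s ∉ V.ideal) :
    (germ V hF hs hsV).val = Localization.mk F (⟨s, hsV⟩ : V.ideal.primeCompl) := by
  rw [germ, HomogeneousLocalization.val_mk]

theorem germ_mul_germ {V : Subvariety a b} {d e : ℕ × ℕ} {F s G t : BiRing a b}
    (hF : F ∈ bigrading a b d) (hs : s ∈ bigrading a b d) (hsV : s ∉ V.ideal)
    (hG : G ∈ bigrading a b e) (ht : t ∈ bigrading a b e) (htV : t ∉ V.ideal) :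
    germ V hF hs hsV * germ V hG ht htV =
      germ V (SetLike.mul_mem_graded hF hG) (SetLike.mul_mem_graded hs ht)
        (V.isPrime.mul_notMem hsV htV) :=
  rfl

theorem germ_eq_germ {V : Subvariety a b} {d e : ℕ × ℕ} {F s G t : BiRing a b}
    (hF : F ∈ bigrading a b d) (hs : s ∈ bigrading a b d) (hsV : s ∉ V.ideal)
    (hG : G ∈ bigrading a b e) (ht : t ∈ bigrading a b e) (htV : t ∉ V.ideal)
    (h : t * F = s * G) : germ V hF hs hsV = germ V hG ht htV := by
  apply HomogeneousLocalization.val_injective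
  rw [val_germ, val_germ, Localization.mk_eq_mk_iff, Localization.r_iff_exists]
  exact ⟨1, by simpa using h⟩

theorem germ_self {V : Subvariety a b} {d : ℕ × ℕ} {s : BiRing a b}
    (hs : s ∈ bigrading a b d) (hsV : s ∉ V.ideal) : germ V hs hs hsV = 1 := by
  apply HomogeneousLocalization.val_injective
  rw [val_germ, HomogeneousLocalization.val_one]
  exact Localization.mk_self (⟨s, hsV⟩ : V.ideal.primeCompl)

theorem isUnit_germ {V : Subvariety a b} {d : ℕ × ℕ} {F s : BiRing a b} (hF : F ∈ bigrading a b d)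
    (hs : s ∈ bigrading a b d) (hsV : s ∉ V.ideal) (hFV : F ∉ V.ideal) :
    IsUnit (germ V hF hs hsV) := by
  refine IsUnit.of_mul_eq_one (germ V hs hF hFV) ?_
  rw [germ_mul_germ, ← germ_self (V := V) hs hsV]
  exact germ_eq_germ _ _ _ _ _ _ (by ring)

theorem germ_mem_localIdeal_iff {W V : Subvariety a b} (hWV : W.ideal ≤ V.ideal) {d : ℕ × ℕ}
    {F s : BiRing a b} (hF : F ∈ bigrading a b d) (hs : s ∈ bigrading a b d) (hsV : s ∉ V.ideal) :
    germ V hF hs hsV ∈ localIdeal W V ↔ F ∈ W.ideal := by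
  rw [localIdeal, Ideal.mem_comap, HomogeneousLocalization.algebraMap_apply, val_germ,
    Localization.mk_eq_mk', IsLocalization.mk'_mem_map_algebraMap_iff]
  constructor
  · rintro ⟨t, ht, h⟩
    exact (W.isPrime.mem_or_mem h).resolve_left fun h' => ht (hWV h')
  · intro h
    exact ⟨1, V.ideal.primeCompl.one_mem, by simpa using h⟩

theorem isPrime_localIdeal {W V : Subvariety a b} (hWV : W.ideal ≤ V.ideal) :
    (localIdeal W V).IsPrime := by
  have hd : Disjoint (V.ideal.primeCompl : Set (BiRing a b)) W.ideal :=
    Set.disjoint_left.2 fun _ hs h => hs (hWV h)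
  have := IsLocalization.isPrime_of_isPrime_disjoint V.ideal.primeCompl
    (Localization.AtPrime V.ideal) W.ideal W.isPrime hd
  exact Ideal.IsPrime.comap _

theorem germ_mem_maximalIdeal_iff {V : Subvariety a b} {d : ℕ × ℕ} {F s : BiRing a b}
    (hF : F ∈ bigrading a b d) (hs : s ∈ bigrading a b d) (hsV : s ∉ V.ideal) :
    germ V hF hs hsV ∈ IsLocalRing.maximalIdeal (AmbientLocalRing V) ↔ F ∈ V.ideal := by
  rw [IsLocalRing.mem_maximalIdeal, mem_nonunits_iff]
  refine ⟨fun h => by_contra fun hFV => h (isUnit_germ hF hs hsV hFV), fun h hu => ?_⟩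
  obtain ⟨x, hx⟩ := hu.exists_right_inv
  obtain ⟨e, G, t, hG, ht, htV, rfl⟩ := exists_eq_germ x
  rw [germ_mul_germ, ← germ_self hs hsV] at hx
  have hv := congrArg HomogeneousLocalization.val hx
  rw [val_germ, val_germ, Localization.mk_eq_mk_iff, Localization.r_iff_exists] at hv
  obtain ⟨c, hc⟩ := hv
  have h1 : (c : BiRing a b) * (s * (F * G)) ∈ V.ideal :=
    V.ideal.mul_mem_left _ (V.ideal.mul_mem_left _ (V.ideal.mul_mem_right _ h))
  have h2 : (c : BiRing a b) * (s * t * s) ∈ V.ideal := by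
    have hc' : (c : BiRing a b) * (s * (F * G)) = c * (s * t * s) := by simpa using hc
    rwa [← hc']
  exact V.isPrime.mul_notMem c.2 (V.isPrime.mul_notMem (V.isPrime.mul_notMem hsV htV) hsV) h2

/-- The order of `F` along `V` can be computed with any denominator that is a unit along `V`. -/
theorem ringOrd_localEquation (W V : Subvariety a b) {d : ℕ × ℕ} {F s : BiRing a b}
    (hF : F ∈ bigrading a b d) (hs : s ∈ bigrading a b d) (hsV : s ∉ V.ideal) :
    Ring.ord (LocalRingAlong W V) (localEquation W V hF) =
      Ring.ord (LocalRingAlong W V) (Ideal.Quotient.mk (localIdeal W V) (germ V hF hs hsV)) := by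
  have h : germ V hF (chartMonomial_mem V d) (chartMonomial_not_mem V d) =
      germ V hs (chartMonomial_mem V d) (chartMonomial_not_mem V d) * germ V hF hs hsV := by
    rw [germ_mul_germ]
    exact germ_eq_germ _ _ _ _ _ _ (by ring)
  have hu := (isUnit_germ hs (chartMonomial_mem V d) (chartMonomial_not_mem V d) hsV).map
    (Ideal.Quotient.mk (localIdeal W V))
  have h' : localEquation W V hF = Ideal.Quotient.mk (localIdeal W V)
      (germ V hs (chartMonomial_mem V d) (chartMonomial_not_mem V d)) *
        Ideal.Quotient.mk (localIdeal W V) (germ V hF hs hsV) := by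
    rw [← map_mul, ← h]
    rfl
  rw [h', Ring.ord_mul_of_isUnit_left hu]

theorem ringOrd_localEquation_of_notMem (W V : Subvariety a b) {d : ℕ × ℕ} {F : BiRing a b}
    (hF : F ∈ bigrading a b d) (hFV : F ∉ V.ideal) :
    Ring.ord (LocalRingAlong W V) (localEquation W V hF) = 0 :=
  Ring.ord_of_isUnit ((isUnit_germ hF (chartMonomial_mem V d) (chartMonomial_not_mem V d) hFV).map
    (Ideal.Quotient.mk (localIdeal W V)))

/-- If `F` and `I(W)` generate `I(V)` up to multipliers outside of `I(V)`, then `F` is a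
uniformizer of `W` along `V`. -/
theorem ringOrd_localEquation_eq_one {W V : Subvariety a b} (hWV : W.ideal ≤ V.ideal)
    {d : ℕ × ℕ} {F : BiRing a b} (hF : F ∈ bigrading a b d) (hFV : F ∈ V.ideal)
    (h : ∀ G ∈ V.ideal, ∃ s ∉ V.ideal, s * G ∈ W.ideal ⊔ Ideal.span {F}) :
    Ring.ord (LocalRingAlong W V) (localEquation W V hF) = 1 := by
  have hQ : (W.ideal ⊔ Ideal.span {F}).IsHomogeneous (bigrading a b) :=
    Ideal.IsHomogeneous.sup W.isHomogeneous
      (Ideal.homogeneous_span _ _ fun x hx => ⟨d, by rwa [Set.mem_singleton_iff.1 hx]⟩)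
  set c := chartMonomial V d with hc
  have hcm : c ∈ bigrading a b d := chartMonomial_mem V d
  have hcV : c ∉ V.ideal := chartMonomial_not_mem V d
  have hle : localIdeal W V ≤ IsLocalRing.maximalIdeal (AmbientLocalRing V) :=
    IsLocalRing.le_maximalIdeal (isPrime_localIdeal hWV).ne_top
  have hmap : Ideal.span {localEquation W V hF} =
      (IsLocalRing.maximalIdeal (AmbientLocalRing V)).map (Ideal.Quotient.mk (localIdeal W V)) := by
    apply le_antisymm
    · rw [Ideal.span_singleton_le_iff_mem]
      exact Ideal.mem_map_of_mem _ ((germ_mem_maximalIdeal_iff hF hcm hcV).2 hFV)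
    · rw [Ideal.map_le_iff_le_comap]
      intro x hx
      obtain ⟨e, G, t, hG, ht, htV, rfl⟩ := exists_eq_germ x
      have hGV := (germ_mem_maximalIdeal_iff hG ht htV).1 hx
      obtain ⟨s, hsV, hsG⟩ := h G hGV
      -- pass to a homogeneous multiplier
      obtain ⟨i, hi⟩ : ∃ i, (DirectSum.decompose (bigrading a b) s i : BiRing a b) ∉ V.ideal := by
        by_contra! hall
        exact hsV (V.isHomogeneous.mem_iff.2 hall)
      set s' : BiRing a b := (DirectSum.decompose (bigrading a b) s i : BiRing a b) with hs'
      have hs'm : s' ∈ bigrading a b i := SetLike.coe_mem _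
      have hs'G : s' * G ∈ W.ideal ⊔ Ideal.span {F} := by
        have h1 := hQ (i + e) hsG
        rwa [DirectSum.coe_decompose_mul_add_of_right_mem (bigrading a b) hG] at h1
      -- multiplying by the chart monomial makes the degree at least that of `F`
      obtain ⟨w, hw, y, hy, hwy⟩ := Submodule.mem_sup.1 (Ideal.mul_mem_left _ c hs'G)
      obtain ⟨r, rfl⟩ := Ideal.mem_span_singleton.1 hy
      set w' : BiRing a b := (DirectSum.decompose (bigrading a b) w (d + (i + e)) : BiRing a b)
      set r' : BiRing a b := (DirectSum.decompose (bigrading a b) r (i + e) : BiRing a b)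
      have hr'm : r' ∈ bigrading a b (i + e) := SetLike.coe_mem _
      have hw'W : w' ∈ W.ideal := W.isHomogeneous _ hw
      have hprod : c * (s' * G) ∈ bigrading a b (d + (i + e)) :=
        SetLike.mul_mem_graded hcm (SetLike.mul_mem_graded hs'm hG)
      have hdec : w' + F * r' = c * (s' * G) := by
        have h1 := congrArg (fun p => (DirectSum.decompose (bigrading a b) p (d + (i + e)) :
          BiRing a b)) hwy
        simp only [DirectSum.decompose_add, DirectSum.add_apply, Submodule.coe_add,
          DirectSum.coe_decompose_mul_add_of_left_mem (bigrading a b) hF,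
          DirectSum.decompose_of_mem_same (bigrading a b) hprod] at h1
        exact h1
      have hst : s' * t ∉ V.ideal := V.isPrime.mul_notMem hi htV
      have hstm : s' * t ∈ bigrading a b (i + e) := SetLike.mul_mem_graded hs'm ht
      have hdiff : germ V hG ht htV - germ V hF hcm hcV * germ V hr'm hstm hst ∈
          localIdeal W V := by
        have hwm : w' ∈ bigrading a b (d + (i + e)) := SetLike.coe_mem _
        have hcst : c * (s' * t) ∈ bigrading a b (d + (i + e)) := SetLike.mul_mem_graded hcm hstm
        have hcstV : c * (s' * t) ∉ V.ideal := V.isPrime.mul_notMem hcV hst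
        have : germ V hG ht htV - germ V hF hcm hcV * germ V hr'm hstm hst =
            germ V hwm hcst hcstV := by
          have e1 : germ V hG ht htV = germ V hprod hcst hcstV :=
            germ_eq_germ _ _ _ _ _ _ (by ring)
          rw [sub_eq_iff_eq_add, e1, germ_mul_germ]
          apply HomogeneousLocalization.val_injective
          rw [HomogeneousLocalization.val_add, val_germ, val_germ, val_germ,
            Localization.add_mk_self, hdec]
        rw [this, germ_mem_localIdeal_iff hWV]
        exact hw'W
      rw [Ideal.mem_comap, Ideal.Quotient.eq.2 hdiff, map_mul]
      exact Ideal.mul_mem_right _ _ (Ideal.mem_span_singleton_self _)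
  refine ringOrd_eq_one ?_
  rw [hmap]
  exact Ideal.IsMaximal.map_of_surjective_of_ker_le Ideal.Quotient.mk_surjective
    (by rwa [Ideal.mk_ker])

theorem ringOrd_localEquation_pow {W V : Subvariety a b} (hWV : W.ideal ≤ V.ideal)
    {d e : ℕ × ℕ} {F : BiRing a b} (hF : F ∈ bigrading a b d) (hFW : F ∉ W.ideal) (k : ℕ)
    (hFk : F ^ k ∈ bigrading a b e) (he : k • d = e) :
    Ring.ord (LocalRingAlong W V) (localEquation W V hFk) =
      k • Ring.ord (LocalRingAlong W V) (localEquation W V hF) := by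
  subst he
  have := isPrime_localIdeal hWV
  have hcV : chartMonomial V d ^ k ∉ V.ideal := fun h =>
    chartMonomial_not_mem V d (V.isPrime.mem_of_pow_mem _ h)
  rw [ringOrd_localEquation W V hFk (SetLike.pow_mem_graded k (chartMonomial_mem V d)) hcV,
    ← Ring.ord_pow]
  · rw [localEquation, ← map_pow]
    rfl
  · refine mem_nonZeroDivisors_of_ne_zero fun h0 => hFW ?_
    have h1 := Ideal.Quotient.eq_zero_iff_mem.1 h0
    exact (germ_mem_localIdeal_iff hWV hF (chartMonomial_mem V d) (chartMonomial_not_mem V d)).1 h1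

end LocalRings

/-! ### The hyperplane `ℙᵃ × ℙᵇ ⊂ ℙᵃ⁺¹ × ℙᵇ` and cones -/

section Hyperplane

variable {a b : ℕ}

/-- A substitution of forms of bidegrees `(1, 0)` and `(0, 1)` for the variables preserves
bidegrees. -/
theorem aeval_mem_bigrading {a' b' : ℕ} {t : Fin (a + 1) ⊕ Fin (b + 1) → BiRing a' b'}
    (hl : ∀ i, t (Sum.inl i) ∈ bigrading a' b' (1, 0))
    (hr : ∀ j, t (Sum.inr j) ∈ bigrading a' b' (0, 1)) {d : ℕ × ℕ} {F : BiRing a b}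
    (hF : F ∈ bigrading a b d) : aeval t F ∈ bigrading a' b' d := by
  rw [aeval_def, eval₂_eq']
  refine Submodule.sum_mem _ fun m hm => ?_
  rw [← Algebra.smul_def]
  refine Submodule.smul_mem _ _ ?_
  have hw := hF (mem_support_iff.1 hm)
  rw [Finsupp.weight_apply, Finsupp.sum_fintype _ _ (by simp)] at hw
  rw [← hw]
  refine SetLike.prod_mem_graded _ _ _ fun i _ => SetLike.pow_mem_graded _ ?_
  cases i with
  | inl i => exact hl i
  | inr j => exact hr j

/-- The last coordinate of `ℙᵃ⁺¹`, as a bihomogeneous polynomial. -/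
def lastVar (a b : ℕ) : BiRing (a + 1) b := X (Sum.inl (Fin.last (a + 1)))

theorem lastVar_mem (a b : ℕ) : lastVar a b ∈ bigrading (a + 1) b (1, 0) :=
  X_inl_mem (a + 1) b _

/-- Restriction of bihomogeneous polynomials to the hyperplane where the last coordinate of
`ℙᵃ⁺¹` vanishes. -/
def restrictHom (a b : ℕ) : bigrading (a + 1) b →+*ᵍ bigrading a b where
  toRingHom := (aeval (Sum.elim (Fin.snoc (fun i => X (Sum.inl i)) 0)
    (fun j => X (Sum.inr j))) : BiRing (a + 1) b →ₐ[ℂ] BiRing a b)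
  map_mem := by
    intro d F hF
    refine aeval_mem_bigrading (a := a + 1) (b := b) (fun i => ?_) (fun j => X_inr_mem a b j) hF
    refine Fin.lastCases ?_ (fun i => ?_) i
    · simp
    · simpa using X_inl_mem a b i

/-- Polynomials on `ℙᵃ × ℙᵇ` as polynomials on `ℙᵃ⁺¹ × ℙᵇ` that do not involve the last
coordinate. -/
def coneHom (a b : ℕ) : bigrading a b →+*ᵍ bigrading (a + 1) b where
  toRingHom := (aeval (Sum.elim (fun i => X (Sum.inl i.castSucc)) (fun j => X (Sum.inr j))) :
    BiRing a b →ₐ[ℂ] BiRing (a + 1) b)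
  map_mem := fun hF => aeval_mem_bigrading (a := a) (b := b) (a' := a + 1) (b' := b)
    (t := Sum.elim (fun i => X (Sum.inl i.castSucc)) (fun j => X (Sum.inr j)))
    (fun _ => X_inl_mem (a + 1) b _) (fun j => X_inr_mem (a + 1) b j) hF

theorem restrictHom_apply (F : BiRing (a + 1) b) : restrictHom a b F =
    aeval (Sum.elim (Fin.snoc (fun i => X (Sum.inl i)) 0) (fun j => X (Sum.inr j))) F := rfl

theorem coneHom_apply (F : BiRing a b) : coneHom a b F =
    aeval (Sum.elim (fun i => X (Sum.inl i.castSucc)) (fun j => X (Sum.inr j))) F := rfl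

@[simp] theorem restrictHom_lastVar : restrictHom a b (lastVar a b) = 0 := by
  simp [restrictHom_apply, lastVar]

@[simp] theorem restrictHom_X_castSucc (i : Fin (a + 1)) :
    restrictHom a b (X (Sum.inl i.castSucc)) = X (Sum.inl i) := by
  simp [restrictHom_apply]

@[simp] theorem restrictHom_X_inr (j : Fin (b + 1)) :
    restrictHom a b (X (Sum.inr j)) = X (Sum.inr j) := by
  simp [restrictHom_apply]

@[simp] theorem coneHom_X_inl (i : Fin (a + 1)) :
    coneHom a b (X (Sum.inl i)) = X (Sum.inl i.castSucc) := by
  simp [coneHom_apply]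

@[simp] theorem coneHom_X_inr (j : Fin (b + 1)) :
    coneHom a b (X (Sum.inr j)) = X (Sum.inr j) := by
  simp [coneHom_apply]

@[simp] theorem restrictHom_coneHom (F : BiRing a b) : restrictHom a b (coneHom a b F) = F := by
  rw [restrictHom_apply, coneHom_apply]
  induction F using MvPolynomial.induction_on with
  | C c => simp
  | add p q hp hq => simp only [map_add, hp, hq]
  | mul_X p i hp =>
    rw [map_mul, map_mul, hp]
    cases i <;> simp

theorem restrictHom_surjective : Function.Surjective (restrictHom a b) :=
  fun F => ⟨coneHom a b F, restrictHom_coneHom F⟩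

/-- The coordinate ring of `ℙᵃ⁺¹ × ℙᵇ` is the polynomial ring in the last variable over the
coordinate ring of `ℙᵃ × ℙᵇ`. -/
def polyEquiv (a b : ℕ) : BiRing (a + 1) b ≃+* Polynomial (BiRing a b) :=
  RingEquiv.ofRingHom
    (aeval (Sum.elim (Fin.snoc (fun i => Polynomial.C (X (Sum.inl i))) Polynomial.X)
      (fun j => Polynomial.C (X (Sum.inr j)))) : BiRing (a + 1) b →ₐ[ℂ] _).toRingHom
    (Polynomial.eval₂RingHom (coneHom a b).toRingHom (lastVar a b))
    (by
      refine Polynomial.ringHom_ext' (MvPolynomial.ringHom_ext (fun c => ?_) fun i => ?_) ?_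
      · simp [coneHom, Polynomial.algebraMap_eq, MvPolynomial.algebraMap_eq,
          IsScalarTower.algebraMap_apply ℂ (BiRing a b) (Polynomial (BiRing a b))]
      · cases i <;> simp [coneHom]
      · simp [lastVar])
    (by
      refine MvPolynomial.ringHom_ext (fun c => ?_) fun i => ?_
      · simp [coneHom, Polynomial.algebraMap_eq, MvPolynomial.algebraMap_eq,
          IsScalarTower.algebraMap_apply ℂ (BiRing a b) (Polynomial (BiRing a b))]
      · cases i with
        | inl i =>
          refine Fin.lastCases ?_ (fun i => ?_) i
          · simp [lastVar]
          · simp [coneHom]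
        | inr j => simp [coneHom])

@[simp] theorem polyEquiv_lastVar : polyEquiv a b (lastVar a b) = Polynomial.X := by
  simp [polyEquiv, lastVar]

@[simp] theorem polyEquiv_symm_C (F : BiRing a b) :
    (polyEquiv a b).symm (Polynomial.C F) = coneHom a b F := by
  simp [polyEquiv, coneHom]

@[simp] theorem polyEquiv_coneHom (F : BiRing a b) :
    polyEquiv a b (coneHom a b F) = Polynomial.C F := by
  rw [← polyEquiv_symm_C, RingEquiv.apply_symm_apply]

theorem lastVar_dvd_sub_coneHom (F : BiRing (a + 1) b) :
    lastVar a b ∣ F - coneHom a b (restrictHom a b F) := by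
  induction F using MvPolynomial.induction_on with
  | C c =>
    rw [restrictHom_apply, aeval_C, coneHom_apply, MvPolynomial.algebraMap_eq, aeval_C,
      MvPolynomial.algebraMap_eq, sub_self]
    exact dvd_zero _
  | add p q hp hq =>
    rw [map_add, map_add, add_sub_add_comm]
    exact dvd_add hp hq
  | mul_X p i hp =>
    have hX : lastVar a b ∣ X i - coneHom a b (restrictHom a b (X i)) := by
      cases i with
      | inl i =>
        refine Fin.lastCases ?_ (fun i => ?_) i
        · change lastVar a b ∣ lastVar a b - coneHom a b (restrictHom a b (lastVar a b))
          simp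
        · simp
      | inr j => simp
    rw [map_mul, map_mul]
    have e : p * X i - coneHom a b (restrictHom a b p) * coneHom a b (restrictHom a b (X i)) =
        (p - coneHom a b (restrictHom a b p)) * X i +
          coneHom a b (restrictHom a b p) * (X i - coneHom a b (restrictHom a b (X i))) := by
      ring
    rw [e]
    exact dvd_add (Dvd.dvd.mul_right hp _) (Dvd.dvd.mul_left hX _)

theorem eval_coneHom (v : Fin (a + 1) → ℂ) (z : ℂ) (w : Fin (b + 1) → ℂ) (F : BiRing a b) :
    eval (Sum.elim (Fin.snoc v z) w) (coneHom a b F) = eval (Sum.elim v w) F := by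
  rw [coneHom_apply]
  induction F using MvPolynomial.induction_on with
  | C c => simp
  | add p q hp hq => simp only [map_add, hp, hq]
  | mul_X p i hp =>
    rw [map_mul, map_mul, map_mul, hp]
    cases i <;> simp

theorem eval_restrictHom (v : Fin (a + 1) → ℂ) (w : Fin (b + 1) → ℂ) (F : BiRing (a + 1) b) :
    eval (Sum.elim v w) (restrictHom a b F) = eval (Sum.elim (Fin.snoc v 0) w) F := by
  obtain ⟨G, hG⟩ := lastVar_dvd_sub_coneHom F
  have h := congrArg (eval (Sum.elim (Fin.snoc v 0 : Fin (a + 1 + 1) → ℂ) w)) hG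
  rw [map_sub, map_mul, eval_coneHom] at h
  have hz : eval (Sum.elim (Fin.snoc v 0 : Fin (a + 1 + 1) → ℂ) w) (lastVar a b) = 0 := by
    simp [lastVar]
  rw [hz, zero_mul, sub_eq_zero] at h
  exact h.symm

/-- A subvariety of `ℙᵃ × ℙᵇ` as a subvariety of `ℙᵃ⁺¹ × ℙᵇ` inside of the hyperplane where the
last coordinate of `ℙᵃ⁺¹` vanishes. -/
def Subvariety.embed (V : Subvariety a b) : Subvariety (a + 1) b where
  ideal := V.ideal.comap (restrictHom a b)
  isPrime := Ideal.IsPrime.comap _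
  isHomogeneous :=
    (HomogeneousIdeal.comap (restrictHom a b) ⟨V.ideal, V.isHomogeneous⟩).isHomogeneous
  exists_left := by
    obtain ⟨i, hi⟩ := V.exists_left
    exact ⟨i.castSucc, by simpa [Ideal.mem_comap] using hi⟩
  exists_right := by
    obtain ⟨j, hj⟩ := V.exists_right
    exact ⟨j, by simpa [Ideal.mem_comap] using hj⟩

theorem Subvariety.mem_embed_ideal {V : Subvariety a b} {F : BiRing (a + 1) b} :
    F ∈ V.embed.ideal ↔ restrictHom a b F ∈ V.ideal := Iff.rfl

theorem Subvariety.lastVar_mem_embed (V : Subvariety a b) : lastVar a b ∈ V.embed.ideal := by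
  simp [mem_embed_ideal]

theorem Subvariety.embed_ideal_le_iff {V W : Subvariety a b} :
    V.embed.ideal ≤ W.embed.ideal ↔ V.ideal ≤ W.ideal := by
  refine ⟨fun h F hF => ?_, fun h => Ideal.comap_mono h⟩
  have := h (show coneHom a b F ∈ V.embed.ideal by simpa [mem_embed_ideal] using hF)
  simpa [mem_embed_ideal] using this

theorem Subvariety.embed_injective :
    Function.Injective (Subvariety.embed : Subvariety a b → Subvariety (a + 1) b) := by
  intro V W h
  have h' := congrArg Subvariety.ideal h
  exact Subvariety.ext (le_antisymm (embed_ideal_le_iff.1 h'.le) (embed_ideal_le_iff.1 h'.ge))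

/-- The closure of the image of `U` under the projection `ℙᵃ⁺¹ ⇢ ℙᵃ` that forgets the last
coordinate. Its ideal is the intersection of the ideal of `U` with the coordinate ring of
`ℙᵃ × ℙᵇ`; the hypothesis says that `U` does not lie over the center `(0 : ⋯ : 0 : 1)`. -/
def Subvariety.project (U : Subvariety (a + 1) b)
    (h : ∃ i : Fin (a + 1), (X (Sum.inl i.castSucc) : BiRing (a + 1) b) ∉ U.ideal) :
    Subvariety a b where
  ideal := U.ideal.comap (coneHom a b)
  isPrime := Ideal.IsPrime.comap _
  isHomogeneous := (HomogeneousIdeal.comap (coneHom a b) ⟨U.ideal, U.isHomogeneous⟩).isHomogeneous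
  exists_left := by
    obtain ⟨i, hi⟩ := h
    exact ⟨i, by simpa [Ideal.mem_comap] using hi⟩
  exists_right := by
    obtain ⟨j, hj⟩ := U.exists_right
    exact ⟨j, by simpa [Ideal.mem_comap] using hj⟩

theorem Subvariety.mem_project_ideal {U : Subvariety (a + 1) b} {h} {F : BiRing a b} :
    F ∈ (U.project h).ideal ↔ coneHom a b F ∈ U.ideal := Iff.rfl

theorem Subvariety.exists_embed_eq {U : Subvariety (a + 1) b} (h : lastVar a b ∈ U.ideal) :
    ∃ V : Subvariety a b, V.embed = U := by
  have hi : ∃ i : Fin (a + 1), (X (Sum.inl i.castSucc) : BiRing (a + 1) b) ∉ U.ideal := by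
    obtain ⟨i, hi⟩ := U.exists_left
    induction i using Fin.lastCases with
    | last => exact absurd h hi
    | cast i => exact ⟨i, hi⟩
  refine ⟨U.project hi, Subvariety.ext (Ideal.ext fun F => ?_)⟩
  rw [mem_embed_ideal, mem_project_ideal]
  have := U.ideal.mem_of_dvd (lastVar_dvd_sub_coneHom F) h
  exact ⟨fun hF => by simpa using add_mem this hF, fun hF => by simpa using sub_mem hF this⟩

theorem map_coneHom_eq (I : Ideal (BiRing a b)) : I.map (coneHom a b) =
    (I.map (Polynomial.C : BiRing a b →+* _)).comap (polyEquiv a b) := by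
  apply le_antisymm
  · rw [Ideal.map_le_iff_le_comap]
    intro F hF
    rw [Ideal.mem_comap, Ideal.mem_comap, polyEquiv_coneHom]
    exact Ideal.mem_map_of_mem _ hF
  · intro G hG
    have h : I.map (Polynomial.C : BiRing a b →+* _) ≤
        (I.map (coneHom a b)).comap (polyEquiv a b).symm := by
      rw [Ideal.map_le_iff_le_comap]
      intro F hF
      rw [Ideal.mem_comap, Ideal.mem_comap, polyEquiv_symm_C]
      exact Ideal.mem_map_of_mem _ hF
    simpa using h hG

theorem map_coneHom_le_comap (I : Ideal (BiRing a b)) :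
    I.map (coneHom a b) ≤ I.comap (restrictHom a b) := by
  rw [Ideal.map_le_iff_le_comap]
  intro F hF
  simpa [Ideal.mem_comap] using hF

/-- The cone over a subvariety of `ℙᵃ × ℙᵇ`, with the point `(0 : ⋯ : 0 : 1)` of `ℙᵃ⁺¹` as its
vertex. -/
def Subvariety.cone (V : Subvariety a b) : Subvariety (a + 1) b where
  ideal := V.ideal.map (coneHom a b)
  isPrime := by
    rw [map_coneHom_eq]
    have : (V.ideal.map (Polynomial.C : BiRing a b →+* _)).IsPrime :=
      Ideal.isPrime_map_C_of_isPrime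
    exact Ideal.IsPrime.comap _
  isHomogeneous := (HomogeneousIdeal.map (coneHom a b) ⟨V.ideal, V.isHomogeneous⟩).isHomogeneous
  exists_left := by
    obtain ⟨i, hi⟩ := V.exists_left
    exact ⟨i.castSucc, fun h => hi (by simpa using map_coneHom_le_comap _ h)⟩
  exists_right := by
    obtain ⟨j, hj⟩ := V.exists_right
    exact ⟨j, fun h => hj (by simpa using map_coneHom_le_comap _ h)⟩

theorem Subvariety.cone_le_embed (V : Subvariety a b) : V.cone.ideal ≤ V.embed.ideal :=
  map_coneHom_le_comap V.ideal

theorem Subvariety.coneHom_mem_cone_iff {V : Subvariety a b} {F : BiRing a b} :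
    coneHom a b F ∈ V.cone.ideal ↔ F ∈ V.ideal :=
  ⟨fun h => by simpa [mem_embed_ideal] using V.cone_le_embed h, fun h => Ideal.mem_map_of_mem _ h⟩

theorem Subvariety.embed_le_cone_sup (V : Subvariety a b) :
    V.embed.ideal ≤ V.cone.ideal ⊔ Ideal.span {lastVar a b} := by
  intro F hF
  have h1 : coneHom a b (restrictHom a b F) ∈ V.cone.ideal := Ideal.mem_map_of_mem _ hF
  have h2 := Ideal.mem_span_singleton.2 (lastVar_dvd_sub_coneHom F)
  simpa using add_mem (Ideal.mem_sup_left h1) (Ideal.mem_sup_right h2)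

end Hyperplane

/-! ### Push-forward of cycles from the hyperplane -/

section PushForward

variable {a b : ℕ}

theorem isPrimeDivisor_embed_iff {W V : Subvariety a b} :
    IsPrimeDivisor W.embed V.embed ↔ IsPrimeDivisor W V := by
  unfold IsPrimeDivisor
  refine and_congr ?_ ⟨fun h U hWU hUV => ?_, fun h U hWU hUV => ?_⟩
  · simp only [lt_iff_le_not_ge, Subvariety.embed_ideal_le_iff]
  · simpa only [Subvariety.embed_injective.eq_iff] using
      h U.embed (Subvariety.embed_ideal_le_iff.2 hWU) (Subvariety.embed_ideal_le_iff.2 hUV)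
  · obtain ⟨U, rfl⟩ := Subvariety.exists_embed_eq (hWU W.lastVar_mem_embed)
    simpa only [Subvariety.embed_injective.eq_iff] using
      h U (Subvariety.embed_ideal_le_iff.1 hWU) (Subvariety.embed_ideal_le_iff.1 hUV)

/-- Restriction of germs along `V` to the hyperplane. -/
def germRestrict (V : Subvariety a b) : AmbientLocalRing V.embed →+* AmbientLocalRing V :=
  HomogeneousLocalization.localRingHom (restrictHom a b) V.embed.ideal V.ideal rfl

theorem germRestrict_germ {V : Subvariety a b} {d : ℕ × ℕ} {F s : BiRing (a + 1) b}
    (hF : F ∈ bigrading (a + 1) b d) (hs : s ∈ bigrading (a + 1) b d) (hsV : s ∉ V.embed.ideal) :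
    germRestrict V (germ V.embed hF hs hsV) =
      germ V ((restrictHom a b).map_mem hF) ((restrictHom a b).map_mem hs) hsV :=
  rfl

theorem germRestrict_surjective (V : Subvariety a b) : Function.Surjective (germRestrict V) := by
  intro x
  obtain ⟨d, F, s, hF, hs, hsV, rfl⟩ := exists_eq_germ x
  refine ⟨germ V.embed ((coneHom a b).map_mem hF) ((coneHom a b).map_mem hs) ?_, ?_⟩
  · change restrictHom a b (coneHom a b s) ∉ V.ideal
    rwa [restrictHom_coneHom]
  · rw [germRestrict_germ]
    refine germ_eq_germ _ _ _ _ _ _ ?_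
    change s * restrictHom a b (coneHom a b F) = restrictHom a b (coneHom a b s) * F
    rw [restrictHom_coneHom, restrictHom_coneHom]

theorem comap_germRestrict_localIdeal {W V : Subvariety a b} (hWV : W.ideal ≤ V.ideal) :
    (localIdeal W V).comap (germRestrict V) = localIdeal W.embed V.embed := by
  ext x
  obtain ⟨d, F, s, hF, hs, hsV, rfl⟩ := exists_eq_germ x
  rw [germ_mem_localIdeal_iff (Subvariety.embed_ideal_le_iff.2 hWV)]
  exact germ_mem_localIdeal_iff hWV ((restrictHom a b).map_mem hF) ((restrictHom a b).map_mem hs)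
    hsV

theorem ringOrd_localEquation_embed {W V : Subvariety a b} (hWV : W.ideal ≤ V.ideal)
    {d : ℕ × ℕ} {F : BiRing a b} (hF : F ∈ bigrading a b d) :
    Ring.ord (LocalRingAlong W.embed V.embed)
        (localEquation W.embed V.embed ((coneHom a b).map_mem hF)) =
      Ring.ord (LocalRingAlong W V) (localEquation W V hF) := by
  have hI := comap_germRestrict_localIdeal hWV
  let φ : LocalRingAlong W.embed V.embed →+* LocalRingAlong W V :=
    Ideal.quotientMap (localIdeal W V) (germRestrict V) hI.ge
  have hφ : Function.Bijective φ :=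
    ⟨Ideal.quotientMap_injective' hI.le,
      Ideal.quotientMap_surjective (germRestrict_surjective V)⟩
  have hcm := chartMonomial_mem V.embed d
  have hcV := chartMonomial_not_mem V.embed d
  rw [ringOrd_localEquation W V hF ((restrictHom a b).map_mem hcm) hcV,
    ringOrd_ringEquiv (RingEquiv.ofBijective φ hφ)]
  congr 1
  change Ideal.Quotient.mk _ (germRestrict V (germ V.embed _ hcm hcV)) = _
  rw [germRestrict_germ]
  congr 1
  refine germ_eq_germ _ _ _ _ _ _ ?_
  change _ * restrictHom a b (coneHom a b F) = _ * F
  rw [restrictHom_coneHom]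

/-- The push-forward of cycles along the inclusion of the hyperplane. -/
def embedCycle (a b : ℕ) : Cycle a b →+ Cycle (a + 1) b :=
  Finsupp.mapDomain.addMonoidHom Subvariety.embed

theorem isPrincipalCycle_embedCycle {c : Cycle a b} (hc : IsPrincipalCycle c) :
    IsPrincipalCycle (embedCycle a b c) := by
  classical
  obtain ⟨W, d, F, G, hF, hG, hFW, hGW, h⟩ := hc
  refine ⟨W.embed, d, coneHom a b F, coneHom a b G, (coneHom a b).map_mem hF,
    (coneHom a b).map_mem hG, ?_, ?_, fun V => ?_⟩
  · rwa [Subvariety.mem_embed_ideal, restrictHom_coneHom]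
  · rwa [Subvariety.mem_embed_ideal, restrictHom_coneHom]
  · change Finsupp.mapDomain Subvariety.embed c V = _
    by_cases hV : lastVar a b ∈ V.ideal
    · obtain ⟨V, rfl⟩ := Subvariety.exists_embed_eq hV
      rw [Finsupp.mapDomain_apply Subvariety.embed_injective, h V]
      simp only [isPrimeDivisor_embed_iff]
      refine if_ctx_congr Iff.rfl (fun hWV => ?_) fun _ => rfl
      rw [ordAlong, ordAlong]
      erw [ringOrd_localEquation_embed hWV.1.le hF, ringOrd_localEquation_embed hWV.1.le hG]
    · rw [Finsupp.mapDomain_of_notMem_range, if_neg]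
      · exact fun hWV => hV (hWV.1.le W.lastVar_mem_embed)
      · rintro ⟨V, rfl⟩
        exact hV V.lastVar_mem_embed

/-- The push-forward of cycle classes along the inclusion of the hyperplane. -/
def embedChow (a b : ℕ) : Chow a b →+ Chow (a + 1) b :=
  QuotientAddGroup.map _ _ (embedCycle a b) <| by
    rw [rationallyTrivial, AddSubgroup.closure_le]
    exact fun c hc => AddSubgroup.subset_closure (isPrincipalCycle_embedCycle hc)

theorem embedChow_mk (c : Cycle a b) :
    embedChow a b (QuotientAddGroup.mk c) = QuotientAddGroup.mk (embedCycle a b c) :=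
  rfl

theorem components_of_biVanishingIdeal_eq_comap {S : Set (BiProj a b)}
    {S' : Set (BiProj (a + 1) b)}
    (h : biVanishingIdeal S' = (biVanishingIdeal S).comap (restrictHom a b)) :
    components S' = Subvariety.embed '' components S := by
  have hmin : ∀ V : Subvariety a b, V.embed.ideal ∈ (biVanishingIdeal S').minimalPrimes ↔
      V.ideal ∈ (biVanishingIdeal S).minimalPrimes := by
    intro V
    have hs : Function.Surjective (RingHomClass.toRingHom (restrictHom a b)) :=
      restrictHom_surjective
    have h' : biVanishingIdeal S' =
      (biVanishingIdeal S).comap (RingHomClass.toRingHom (restrictHom a b)) := h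
    rw [h', Ideal.comap_minimalPrimes_eq_of_surjective hs]
    exact (Ideal.comap_injective_of_surjective _ hs).mem_set_image
  ext V
  constructor
  · intro hV
    have hz : lastVar a b ∈ V.ideal := by
      refine hV.le ?_
      rw [h, Ideal.mem_comap, restrictHom_lastVar]
      exact zero_mem _
    obtain ⟨V, rfl⟩ := Subvariety.exists_embed_eq hz
    exact ⟨V, (hmin V).1 hV, rfl⟩
  · rintro ⟨V, hV, rfl⟩
    exact (hmin V).2 hV

theorem embedChow_chowClass {S : Set (BiProj a b)} {S' : Set (BiProj (a + 1) b)}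
    (h : biVanishingIdeal S' = (biVanishingIdeal S).comap (restrictHom a b)) :
    embedChow a b (chowClass S) = chowClass S' := by
  classical
  rw [chowClass, embedChow_mk, chowClass, map_sum]
  congr 1
  have hfin : (components_finite S').toFinset =
      (components_finite S).toFinset.image Subvariety.embed := by
    ext V
    simp [components_of_biVanishingIdeal_eq_comap h]
  rw [hfin, Finset.sum_image fun _ _ _ _ h => Subvariety.embed_injective h]
  refine Finset.sum_congr rfl fun V _ => ?_
  exact Finsupp.mapDomain_single

theorem mem_linearProduct_mk_iff {i j : ℕ} {v : Fin (a + 1) → ℂ} (hv : v ≠ 0)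
    {w : Fin (b + 1) → ℂ} (hw : w ≠ 0) :
    (Projectivization.mk ℂ v hv, Projectivization.mk ℂ w hw) ∈ linearProduct a b i j ↔
      (∀ l : Fin (a + 1), i < (l : ℕ) → v l = 0) ∧ ∀ l : Fin (b + 1), j < (l : ℕ) → w l = 0 := by
  obtain ⟨s, hs⟩ := Projectivization.exists_smul_eq_mk_rep ℂ v hv
  obtain ⟨t, ht⟩ := Projectivization.exists_smul_eq_mk_rep ℂ w hw
  simp [linearProduct, ← hs, ← ht, Units.smul_def]

/-- For `i ≤ a` the linear subspace `ℙⁱ × ℙʲ` lies in the hyperplane. -/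
theorem biVanishingIdeal_linearProduct_succ {i j : ℕ} (hi : i ≤ a) :
    biVanishingIdeal (linearProduct (a + 1) b i j) =
      (biVanishingIdeal (linearProduct a b i j)).comap (restrictHom a b) := by
  ext F
  rw [Ideal.mem_comap, mem_biVanishingIdeal_iff, mem_biVanishingIdeal_iff]
  constructor
  · intro h v hv w hw hS
    rw [eval_restrictHom]
    have hv' : (Fin.snoc v 0 : Fin (a + 1 + 1) → ℂ) ≠ 0 := fun h0 => hv <| funext fun l => by
      simpa using congrFun h0 l.castSucc
    refine h _ hv' w hw ?_
    rw [mem_linearProduct_mk_iff] at hS ⊢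
    refine ⟨fun l => ?_, hS.2⟩
    induction l using Fin.lastCases with
    | last => simp
    | cast l => simpa using hS.1 l
  · intro h v hv w hw hS
    rw [mem_linearProduct_mk_iff] at hS
    have hlast : v (Fin.last (a + 1)) = 0 := hS.1 _ (by simpa using Nat.lt_succ_of_le hi)
    have hsnoc : v = Fin.snoc (fun l => v l.castSucc) 0 := by
      rw [← hlast]
      exact (Fin.snoc_init_self v).symm
    have hv' : (fun l : Fin (a + 1) => v l.castSucc) ≠ 0 := by
      intro h0
      apply hv
      rw [hsnoc, h0]
      ext l
      refine Fin.lastCases ?_ (fun l => ?_) l <;> simp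
    have h1 := h _ hv' w hw ((mem_linearProduct_mk_iff hv' hw).2
      ⟨fun l hl => hS.1 l.castSucc (by simpa using hl), hS.2⟩)
    rwa [eval_restrictHom, ← hsnoc] at h1

end PushForward

/-! ### Prime divisors of a cone that dominate its base -/

section Cone

variable {a b : ℕ}

/-- The subvariety `V` of `ℙᵃ⁺¹ × ℙᵇ` lies in the cone over `Γ` and projects onto a dense subset
of `Γ`. -/
def IsDominantOver (V : Subvariety (a + 1) b) (Γ : Subvariety a b) : Prop :=
  ∀ F, coneHom a b F ∈ V.ideal ↔ F ∈ Γ.ideal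

theorem IsDominantOver.cone_le {V : Subvariety (a + 1) b} {Γ : Subvariety a b}
    (h : IsDominantOver V Γ) : Γ.cone.ideal ≤ V.ideal :=
  Ideal.map_le_iff_le_comap.2 fun F hF => (h F).2 hF

theorem isDominantOver_embed (Γ : Subvariety a b) : IsDominantOver Γ.embed Γ := fun F => by
  rw [Subvariety.mem_embed_ideal, restrictHom_coneHom]

/-- The coordinate ring of the cone over `Γ` is the polynomial ring over the coordinate ring
of `Γ`. -/
def coneQuotient (Γ : Subvariety a b) : BiRing (a + 1) b →+* Polynomial (BiRing a b ⧸ Γ.ideal) :=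
  (Polynomial.mapRingHom (Ideal.Quotient.mk Γ.ideal)).comp (polyEquiv a b : _ →+* _)

theorem coneQuotient_surjective (Γ : Subvariety a b) : Function.Surjective (coneQuotient Γ) :=
  (Polynomial.map_surjective _ Ideal.Quotient.mk_surjective).comp (polyEquiv a b).surjective

theorem ker_coneQuotient (Γ : Subvariety a b) :
    RingHom.ker (coneQuotient Γ) = Γ.cone.ideal := by
  rw [coneQuotient, ← RingHom.comap_ker, Polynomial.ker_mapRingHom, Ideal.mk_ker]
  exact (map_coneHom_eq Γ.ideal).symm

theorem coneQuotient_coneHom (Γ : Subvariety a b) (F : BiRing a b) :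
    coneQuotient Γ (coneHom a b F) = Polynomial.C (Ideal.Quotient.mk Γ.ideal F) := by
  simp [coneQuotient]

theorem coneQuotient_lastVar (Γ : Subvariety a b) :
    coneQuotient Γ (lastVar a b) = Polynomial.X := by
  simp [coneQuotient]

theorem comap_map_coneQuotient {Γ : Subvariety a b} {I : Ideal (BiRing (a + 1) b)}
    (h : Γ.cone.ideal ≤ I) : (I.map (coneQuotient Γ)).comap (coneQuotient Γ) = I := by
  rw [Ideal.comap_map_of_surjective' _ (coneQuotient_surjective Γ), ker_coneQuotient,
    sup_eq_left.2 h]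

theorem isPrime_map_coneQuotient {Γ : Subvariety a b} {V : Subvariety (a + 1) b}
    (h : Γ.cone.ideal ≤ V.ideal) : (V.ideal.map (coneQuotient Γ)).IsPrime :=
  Ideal.map_isPrime_of_surjective (coneQuotient_surjective Γ) (by rwa [ker_coneQuotient])

theorem isDominantOver_iff {Γ : Subvariety a b} {V : Subvariety (a + 1) b}
    (h : Γ.cone.ideal ≤ V.ideal) :
    IsDominantOver V Γ ↔ (V.ideal.map (coneQuotient Γ)).comap Polynomial.C = ⊥ := by
  have hmem : ∀ F, coneHom a b F ∈ V.ideal ↔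
      Polynomial.C (Ideal.Quotient.mk Γ.ideal F) ∈ V.ideal.map (coneQuotient Γ) := fun F => by
    conv_lhs => rw [← comap_map_coneQuotient h, Ideal.mem_comap, coneQuotient_coneHom]
  simp only [IsDominantOver, hmem]
  constructor
  · intro hF
    rw [eq_bot_iff]
    intro x hx
    obtain ⟨F, rfl⟩ := Ideal.Quotient.mk_surjective x
    exact Ideal.Quotient.eq_zero_iff_mem.2 ((hF F).1 hx)
  · intro hbot F
    rw [← Ideal.mem_comap, hbot, Ideal.mem_bot, Ideal.Quotient.eq_zero_iff_mem]

theorem IsDominantOver.eq_or_eq {Γ : Subvariety a b} {V : Subvariety (a + 1) b}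
    (h : IsDominantOver V Γ) {U : Subvariety (a + 1) b} (hU : Γ.cone.ideal ≤ U.ideal)
    (hUV : U.ideal ≤ V.ideal) : U = Γ.cone ∨ U = V := by
  have := isPrime_map_coneQuotient hU
  have := isPrime_map_coneQuotient h.cone_le
  by_cases hbot : U.ideal.map (coneQuotient Γ) = ⊥
  · left
    refine Subvariety.ext ?_
    rw [← comap_map_coneQuotient hU, hbot, ← ker_coneQuotient]
    rfl
  · right
    refine Subvariety.ext ?_
    rw [← comap_map_coneQuotient hU, ← comap_map_coneQuotient h.cone_le,
      Polynomial.eq_of_le_of_comap_C_eq_bot (Ideal.map_mono hUV) hbot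
        ((isDominantOver_iff h.cone_le).1 h)]

/-- Proper subvarieties of the cone that dominate its base are prime divisors. -/
theorem IsDominantOver.isPrimeDivisor {Γ : Subvariety a b} {V : Subvariety (a + 1) b}
    (h : IsDominantOver V Γ) (hne : V ≠ Γ.cone) : IsPrimeDivisor Γ.cone V :=
  ⟨lt_of_le_of_ne h.cone_le fun h' => hne (Subvariety.ext h'.symm), fun _ hU hUV =>
    h.eq_or_eq hU hUV⟩

variable {Γ : Subvariety a b} {k : ℕ} {f : BiRing a b}

theorem coneQuotient_pow_sub (Γ : Subvariety a b) (k : ℕ) (f : BiRing a b) :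
    coneQuotient Γ (lastVar a b ^ k - coneHom a b f) =
      Polynomial.X ^ k - Polynomial.C (Ideal.Quotient.mk Γ.ideal f) := by
  rw [map_sub, map_pow, coneQuotient_lastVar, coneQuotient_coneHom]

/-- The hypersurface `z ^ k = f` of the cone is generically reduced along its components that
dominate the base, because `z ^ k - f` is separable over the function field of the base. -/
theorem IsDominantOver.exists_mul_mem {V : Subvariety (a + 1) b} (h : IsDominantOver V Γ)
    (hk : k ≠ 0) (hf : f ∉ Γ.ideal) (hV : lastVar a b ^ k - coneHom a b f ∈ V.ideal)
    {G : BiRing (a + 1) b} (hG : G ∈ V.ideal) :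
    ∃ s ∉ V.ideal, s * G ∈ Γ.cone.ideal ⊔ Ideal.span {lastVar a b ^ k - coneHom a b f} := by
  have := isPrime_map_coneQuotient h.cone_le
  have : CharZero (BiRing a b ⧸ Γ.ideal) := algebraRat.charZero _
  have hf' : Ideal.Quotient.mk Γ.ideal f ≠ 0 := fun h0 => hf (Ideal.Quotient.eq_zero_iff_mem.1 h0)
  obtain ⟨s, hs, t, ht⟩ := Polynomial.exists_dvd_mul_of_separable
    ((isDominantOver_iff h.cone_le).1 h)
    (by simpa only [coneQuotient_pow_sub] using Ideal.mem_map_of_mem (coneQuotient Γ) hV)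
    (Polynomial.separable_map_X_pow_sub_C hk hf') (Ideal.mem_map_of_mem (coneQuotient Γ) hG)
  obtain ⟨s, rfl⟩ := coneQuotient_surjective Γ s
  obtain ⟨t, rfl⟩ := coneQuotient_surjective Γ t
  refine ⟨s, fun h' => hs (Ideal.mem_map_of_mem _ h'), ?_⟩
  rw [← coneQuotient_pow_sub, ← map_mul, ← map_mul, ← sub_eq_zero, ← map_sub,
    ← RingHom.mem_ker, ker_coneQuotient] at ht
  have h2 : (lastVar a b ^ k - coneHom a b f) * t ∈
      Ideal.span {lastVar a b ^ k - coneHom a b f} :=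
    Ideal.mul_mem_right _ _ (Ideal.mem_span_singleton_self _)
  simpa using add_mem (Ideal.mem_sup_left ht) (Ideal.mem_sup_right h2)

/-- The components of the hypersurface `z ^ k = f` of the cone are its subvarieties that dominate
the base. -/
theorem mem_minimalPrimes_iff (hk : k ≠ 0) {V : Subvariety (a + 1) b} :
    V.ideal ∈ (Γ.cone.ideal ⊔ Ideal.span {lastVar a b ^ k - coneHom a b f}).minimalPrimes ↔
      IsDominantOver V Γ ∧ lastVar a b ^ k - coneHom a b f ∈ V.ideal := by
  have hmon := Polynomial.monic_X_pow_sub_C (Ideal.Quotient.mk Γ.ideal f) hk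
  rw [← coneQuotient_pow_sub] at hmon
  have hcomap : Γ.cone.ideal ⊔ Ideal.span {lastVar a b ^ k - coneHom a b f} =
      (Ideal.span {coneQuotient Γ (lastVar a b ^ k - coneHom a b f)}).comap (coneQuotient Γ) := by
    have hspan := Ideal.map_span (coneQuotient Γ) {lastVar a b ^ k - coneHom a b f}
    rw [Set.image_singleton] at hspan
    rw [← hspan, Ideal.comap_map_of_surjective' _ (coneQuotient_surjective Γ), ker_coneQuotient,
      sup_comm]
  by_cases hle : Γ.cone.ideal ≤ V.ideal
  · have := isPrime_map_coneQuotient hle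
    have hcm := Ideal.comap_minimalPrimes_eq_of_surjective (f := coneQuotient Γ)
      (coneQuotient_surjective Γ)
      (Ideal.span {coneQuotient Γ (lastVar a b ^ k - coneHom a b f)})
    have hinj := Ideal.comap_injective_of_surjective (coneQuotient Γ) (coneQuotient_surjective Γ)
    rw [hcomap, hcm]
    conv_lhs => rw [← comap_map_coneQuotient hle]
    rw [hinj.mem_set_image,
      Polynomial.mem_minimalPrimes_span_singleton_iff hmon, ← isDominantOver_iff hle,
      ← Ideal.mem_comap, comap_map_coneQuotient hle]
  · exact ⟨fun h => absurd (le_sup_left.trans h.le) hle, fun h => absurd h.1.cone_le hle⟩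

/-- A prime divisor of the cone on which `z ^ k = f` dominates the base, because otherwise the
cone over its projection lies strictly in between. -/
theorem IsPrimeDivisor.isDominantOver {V : Subvariety (a + 1) b} (h : IsPrimeDivisor Γ.cone V)
    (hk : k ≠ 0) (hV : lastVar a b ^ k - coneHom a b f ∈ V.ideal)
    (hi : ∃ i : Fin (a + 1), (X (Sum.inl i.castSucc) : BiRing (a + 1) b) ∉ V.ideal) :
    IsDominantOver V Γ := by
  have hle : Γ.cone.ideal ≤ (V.project hi).cone.ideal :=
    Ideal.map_mono fun F hF => h.1.le (Subvariety.coneHom_mem_cone_iff.2 hF)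
  have hle' : (V.project hi).cone.ideal ≤ V.ideal := Ideal.map_le_iff_le_comap.2 le_rfl
  rcases h.2 _ hle hle' with h1 | h1
  · intro F
    rw [← Subvariety.mem_project_ideal (h := hi), ← Subvariety.coneHom_mem_cone_iff, h1,
      Subvariety.coneHom_mem_cone_iff]
  · -- the leading coefficient of `z ^ k - f` would lie in the ideal of the projection
    exfalso
    rw [← h1] at hV
    have h2 : polyEquiv a b (lastVar a b ^ k - coneHom a b f) ∈
        (V.project hi).ideal.map (Polynomial.C : BiRing a b →+* _) := by
      rw [← Ideal.mem_comap, ← map_coneHom_eq]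
      exact hV
    rw [map_sub, map_pow, polyEquiv_lastVar, polyEquiv_coneHom] at h2
    have h3 := Ideal.mem_map_C_iff.1 h2 k
    rw [Polynomial.coeff_sub, Polynomial.coeff_X_pow_self, Polynomial.coeff_C_of_ne_zero hk,
      sub_zero] at h3
    exact (V.project hi).isPrime.one_notMem h3

open Classical in
/-- On the cone over `Γ`, the rational function `(z ^ k - f) / z ^ k` has a simple zero along each
component of `z ^ k = f` and a pole of order `k` along the copy of `Γ` in the hyperplane `z = 0`. -/
theorem isPrincipalCycle_sub (hk : k ≠ 0) (hf : f ∈ bigrading a b (k, 0)) (hfΓ : f ∉ Γ.ideal)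
    (hfX : ∀ V : Subvariety (a + 1) b, coneHom a b f ∉ V.ideal →
      ∃ i : Fin (a + 1), (X (Sum.inl i.castSucc) : BiRing (a + 1) b) ∉ V.ideal)
    {s : Finset (Subvariety (a + 1) b)}
    (hs : ∀ V, V ∈ s ↔
      V.ideal ∈ (Γ.cone.ideal ⊔ Ideal.span {lastVar a b ^ k - coneHom a b f}).minimalPrimes) :
    IsPrincipalCycle ((∑ V ∈ s, Finsupp.single V (1 : ℤ)) - Finsupp.single Γ.embed (k : ℤ)) := by
  have hzk : lastVar a b ^ k ∈ bigrading (a + 1) b (k, 0) := by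
    simpa using SetLike.pow_mem_graded k (lastVar_mem a b)
  have hM : lastVar a b ^ k - coneHom a b f ∈ bigrading (a + 1) b (k, 0) :=
    Submodule.sub_mem _ hzk ((coneHom a b).map_mem hf)
  have hs' : ∀ V, V ∈ s ↔ IsDominantOver V Γ ∧ lastVar a b ^ k - coneHom a b f ∈ V.ideal :=
    fun V => (hs V).trans (mem_minimalPrimes_iff hk)
  have hzΓ : lastVar a b ∉ Γ.cone.ideal := by
    intro h
    have h1 : (Polynomial.X : Polynomial (BiRing a b ⧸ Γ.ideal)) = 0 := by
      rw [← coneQuotient_lastVar, ← RingHom.mem_ker, ker_coneQuotient]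
      exact h
    exact Polynomial.X_ne_zero h1
  have hembed : lastVar a b ^ k - coneHom a b f ∉ Γ.embed.ideal := by
    rw [Subvariety.mem_embed_ideal, map_sub, map_pow, restrictHom_lastVar, zero_pow hk,
      restrictHom_coneHom, zero_sub, neg_mem_iff]
    exact hfΓ
  have hembedne : Γ.embed ≠ Γ.cone := fun h => hzΓ (h ▸ Γ.lastVar_mem_embed)
  have hzs : ∀ V ∈ s, lastVar a b ∉ V.ideal := by
    intro V hV hz
    obtain ⟨h1, h2⟩ := (hs' V).1 hV
    apply hfΓ
    rw [← h1 f]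
    simpa using sub_mem (V.ideal.pow_mem_of_mem hz k (Nat.pos_of_ne_zero hk)) h2
  refine ⟨Γ.cone, (k, 0), lastVar a b ^ k - coneHom a b f, lastVar a b ^ k, hM, hzk,
    fun h => hembed (Γ.cone_le_embed h), fun h => hzΓ (Γ.cone.isPrime.mem_of_pow_mem _ h),
    fun V => ?_⟩
  have hval : ((∑ V ∈ s, Finsupp.single V (1 : ℤ)) - Finsupp.single Γ.embed (k : ℤ) :
      Cycle (a + 1) b) V = (if V ∈ s then 1 else 0) - (if V = Γ.embed then (k : ℤ) else 0) := by
    simp [Finsupp.single_apply, eq_comm]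
  rw [hval]
  by_cases hVs : V ∈ s
  · obtain ⟨h1, h2⟩ := (hs' V).1 hVs
    have hz := hzs V hVs
    have hVe : V ≠ Γ.embed := fun h => hz (h ▸ Γ.lastVar_mem_embed)
    have hVc : V ≠ Γ.cone := fun h => hembed (Γ.cone_le_embed (h ▸ h2))
    rw [if_pos hVs, if_neg hVe, if_pos (h1.isPrimeDivisor hVc), ordAlong,
      ringOrd_localEquation_eq_one h1.cone_le hM h2 fun G hG => h1.exists_mul_mem hk hfΓ h2 hG,
      ringOrd_localEquation_of_notMem _ _ hzk fun h => hz (V.isPrime.mem_of_pow_mem _ h)]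
    rfl
  · rw [if_neg hVs]
    by_cases hVe : V = Γ.embed
    · subst hVe
      have hzE : lastVar a b ∈ Γ.embed.ideal := Γ.lastVar_mem_embed
      have hord : Ring.ord (LocalRingAlong Γ.cone Γ.embed)
          (localEquation Γ.cone Γ.embed (lastVar_mem a b)) = 1 :=
        ringOrd_localEquation_eq_one Γ.cone_le_embed _ hzE fun G hG =>
          ⟨1, Γ.embed.isPrime.one_notMem, by simpa using Γ.embed_le_cone_sup hG⟩
      rw [if_pos rfl, if_pos ((isDominantOver_embed Γ).isPrimeDivisor hembedne), ordAlong,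
        ringOrd_localEquation_of_notMem _ _ hM hembed,
        ringOrd_localEquation_pow Γ.cone_le_embed (lastVar_mem a b) hzΓ k hzk (by simp), hord]
      simp
    · rw [if_neg hVe, sub_zero]
      split_ifs with hdiv
      · have hz : lastVar a b ∉ V.ideal := by
          intro hz
          have hle : Γ.embed.ideal ≤ V.ideal := Γ.embed_le_cone_sup.trans
            (sup_le hdiv.1.le ((Ideal.span_singleton_le_iff_mem _).2 hz))
          rcases hdiv.2 _ Γ.cone_le_embed hle with h | h
          · exact hembedne h
          · exact hVe h.symm
        have hMV : lastVar a b ^ k - coneHom a b f ∉ V.ideal := by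
          intro hMV
          have hfV : coneHom a b f ∉ V.ideal := fun h => hz <| V.isPrime.mem_of_pow_mem k <| by
            simpa using add_mem hMV h
          exact hVs ((hs' V).2 ⟨hdiv.isDominantOver hk hMV (hfX V hfV), hMV⟩)
        rw [ordAlong, ringOrd_localEquation_of_notMem _ _ hM hMV,
          ringOrd_localEquation_of_notMem _ _ hzk fun h => hz (V.isPrime.mem_of_pow_mem _ h)]
        rfl
      · rfl

end Cone

/-! ### The graph of a rational map -/

section Graph

variable {n k : ℕ}

theorem eval_smul_of_isHomogeneous {q : MvPolynomial (Fin (n + 1)) ℂ} (hq : q.IsHomogeneous k)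
    (s : ℂ) (v : Fin (n + 1) → ℂ) : eval (s • v) q = s ^ k * eval v q := by
  rw [eval_eq', eval_eq', Finset.mul_sum]
  refine Finset.sum_congr rfl fun m hm => ?_
  have hw := hq (mem_support_iff.1 hm)
  rw [Finsupp.weight_apply, Finsupp.sum_fintype _ _ (by simp)] at hw
  have h1 : ∑ i, m i = k := by simpa using hw
  simp only [Pi.smul_apply, smul_eq_mul, mul_pow, Finset.prod_mul_distrib,
    Finset.prod_pow_eq_pow_sum, h1]
  ring

/-- The parametrization `(x, t) ↦ (x, t q(x))` of the affine bicone over the graph of the rational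
map `q`, on the level of polynomials. -/
def graphHom (q : Fin (n + 1) → MvPolynomial (Fin (n + 1)) ℂ) :
    BiRing n n →ₐ[ℂ] Polynomial (MvPolynomial (Fin (n + 1)) ℂ) :=
  aeval (Sum.elim (fun i => Polynomial.C (X i)) (fun j => Polynomial.C (q j) * Polynomial.X))

variable {q : Fin (n + 1) → MvPolynomial (Fin (n + 1)) ℂ}

theorem eval_graphHom (G : BiRing n n) (v : Fin (n + 1) → ℂ) (t : ℂ) :
    ((graphHom q G).map (eval v)).eval t = eval (Sum.elim v (t • fun j => eval v (q j))) G := by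
  induction G using MvPolynomial.induction_on with
  | C c => simp [graphHom, IsScalarTower.algebraMap_apply ℂ (MvPolynomial (Fin (n + 1)) ℂ)
      (Polynomial (MvPolynomial (Fin (n + 1)) ℂ)), Polynomial.algebraMap_eq,
      MvPolynomial.algebraMap_eq]
  | add p r hp hr => simp only [map_add, Polynomial.map_add, Polynomial.eval_add, hp, hr]
  | mul_X p i hp =>
    rw [map_mul, Polynomial.map_mul, Polynomial.eval_mul, hp, map_mul]
    cases i with
    | inl i => simp [graphHom]
    | inr j =>
      have h : graphHom q (X (Sum.inr j)) = Polynomial.C (q j) * Polynomial.X := by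
        simp [graphHom, -Polynomial.X_mul_C]
      rw [h, Polynomial.map_mul, Polynomial.map_C, Polynomial.map_X, Polynomial.eval_mul,
        Polynomial.eval_C, Polynomial.eval_X, eval_X, Sum.elim_inr, Pi.smul_apply, smul_eq_mul,
        mul_comm t]

/-- A polynomial vanishes on the bicone over the graph if it does so on a dense open subset. -/
theorem graphHom_eq_zero {h : MvPolynomial (Fin (n + 1)) ℂ} (h0 : h ≠ 0) {G : BiRing n n}
    (hG : ∀ (v : Fin (n + 1) → ℂ) (t : ℂ), eval v h ≠ 0 → t ≠ 0 →
      eval (Sum.elim v (t • fun j => eval v (q j))) G = 0) :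
    graphHom q G = 0 := by
  have hmul : Polynomial.C h * Polynomial.X * graphHom q G = 0 := by
    refine Polynomial.ext fun m => MvPolynomial.funext fun v => ?_
    have h1 : (Polynomial.C h * Polynomial.X * graphHom q G).map (eval v) = 0 := by
      refine Polynomial.funext fun t => ?_
      rw [Polynomial.map_mul, Polynomial.eval_mul, eval_graphHom, Polynomial.map_mul,
        Polynomial.map_C, Polynomial.map_X, Polynomial.eval_mul, Polynomial.eval_C,
        Polynomial.eval_X, Polynomial.eval_zero]
      by_cases hv : eval v h = 0
      · rw [hv, zero_mul, zero_mul]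
      · by_cases ht : t = 0
        · rw [ht, mul_zero, zero_mul]
        · rw [hG v t hv ht, mul_zero]
    rw [← Polynomial.coeff_map, h1]
    simp
  refine (mul_eq_zero.1 hmul).resolve_left (mul_ne_zero ?_ Polynomial.X_ne_zero)
  exact Polynomial.C_ne_zero.2 h0

/-- The vanishing ideal of the graph of a rational map is the kernel of its parametrization. -/
theorem biVanishingIdeal_graphClosure (hq : ∀ j, (q j).IsHomogeneous k) {j : Fin (n + 1)}
    (hj : q j ≠ 0) : biVanishingIdeal (graphClosure q) = RingHom.ker (graphHom q) := by
  rw [graphClosure, biVanishingIdeal_zariskiClosure]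
  ext G
  rw [mem_biVanishingIdeal_iff, RingHom.mem_ker]
  constructor
  · intro h
    refine graphHom_eq_zero (mul_ne_zero hj (X_ne_zero (0 : Fin (n + 1)))) fun v t hvj ht => ?_
    rw [map_mul, eval_X, mul_ne_zero_iff] at hvj
    have hv : v ≠ 0 := fun h0 => hvj.2 (by rw [h0]; rfl)
    have hqv : (fun i => eval v (q i)) ≠ 0 := fun h0 => hvj.1 (congrFun h0 j)
    refine h v hv _ (smul_ne_zero ht hqv) ⟨v, hv, hqv, Prod.ext rfl ?_⟩
    exact (Projectivization.mk_eq_mk_iff' ℂ _ _ _ _).2 ⟨t, rfl⟩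
  · rintro h v hv w hw ⟨u, hu, hqu, heq⟩
    obtain ⟨s, rfl⟩ := (Projectivization.mk_eq_mk_iff' ℂ _ _ _ _).1 (congrArg Prod.fst heq)
    obtain ⟨t, rfl⟩ := (Projectivization.mk_eq_mk_iff' ℂ _ _ _ _).1 (congrArg Prod.snd heq)
    have hs : s ≠ 0 := left_ne_zero_of_smul hv
    have hw' : (t • fun i => eval u (q i)) =
        (t * (s ^ k)⁻¹) • fun i => eval (s • u) (q i) := by
      ext i
      simp only [Pi.smul_apply, smul_eq_mul, eval_smul_of_isHomogeneous (hq i)]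
      field_simp
    rw [hw', ← eval_graphHom, h]
    simp

/-- The graph of the rational map `q`, as a subvariety. -/
def graphSubvariety (q : Fin (n + 1) → MvPolynomial (Fin (n + 1)) ℂ)
    (hq : ∀ j, (q j).IsHomogeneous k) {j : Fin (n + 1)} (hj : q j ≠ 0) : Subvariety n n where
  ideal := biVanishingIdeal (graphClosure q)
  isPrime := by
    rw [biVanishingIdeal_graphClosure hq hj]
    exact RingHom.ker_isPrime _
  isHomogeneous := isHomogeneous_biVanishingIdeal _
  exists_left := ⟨0, by
    rw [biVanishingIdeal_graphClosure hq hj, RingHom.mem_ker]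
    simp [graphHom, X_ne_zero]⟩
  exists_right := ⟨j, by
    rw [biVanishingIdeal_graphClosure hq hj, RingHom.mem_ker]
    simp [graphHom, hj]⟩

theorem mem_graphSubvariety_iff (hq : ∀ j, (q j).IsHomogeneous k) {j : Fin (n + 1)}
    (hj : q j ≠ 0) {G : BiRing n n} :
    G ∈ (graphSubvariety q hq hj).ideal ↔ graphHom q G = 0 := by
  rw [← RingHom.mem_ker, ← biVanishingIdeal_graphClosure hq hj]
  rfl

theorem chowClass_graphClosure (hq : ∀ j, (q j).IsHomogeneous k) {j : Fin (n + 1)}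
    (hj : q j ≠ 0) : chowClass (graphClosure q) =
      QuotientAddGroup.mk (Finsupp.single (graphSubvariety q hq hj) 1) := by
  have hcomp : (components_finite (graphClosure q)).toFinset = {graphSubvariety q hq hj} := by
    ext V
    rw [Set.Finite.mem_toFinset, Finset.mem_singleton, Subvariety.ext_iff]
    change V.ideal ∈ (biVanishingIdeal (graphClosure q)).minimalPrimes ↔ _
    have : (biVanishingIdeal (graphClosure q)).IsPrime := (graphSubvariety q hq hj).isPrime
    rw [Ideal.minimalPrimes_eq_subsingleton_self]
    rfl
  rw [chowClass, hcomp, Finset.sum_singleton]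

end Graph

/-! ### The variety of critical points of `f = 1` -/

section AffineHypersurface

variable {n k : ℕ} {f : MvPolynomial (Fin (n + 1)) ℂ}

theorem logGradient_isHomogeneous (hk : 1 ≤ k) (hf : f.IsHomogeneous k) (i : Fin (n + 1)) :
    (logGradient f i).IsHomogeneous k := by
  have h := (isHomogeneous_X ℂ i).mul (hf.pderiv (i := i))
  rwa [Nat.add_sub_cancel' hk] at h

theorem exists_logGradient_ne_zero (hk : 1 ≤ k) (hf : f.IsHomogeneous k) (hf0 : f ≠ 0) :
    ∃ j, logGradient f j ≠ 0 := by
  by_contra! h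
  have h1 := sum_logGradient hf
  simp only [h, Finset.sum_const_zero] at h1
  have : (k : MvPolynomial (Fin (n + 1)) ℂ) ≠ 0 := by exact_mod_cast (by omega : k ≠ 0)
  exact mul_ne_zero this hf0 h1.symm

theorem logGradient_sub_one (f : MvPolynomial (Fin (n + 1)) ℂ) :
    logGradient (f - 1) = logGradient f := by
  ext1 i
  simp [logGradient]

theorem rename_inl_mem_bigrading (hf : f.IsHomogeneous k) :
    rename Sum.inl f ∈ bigrading n n (k, 0) := by
  intro m hm
  obtain ⟨u, rfl, hu⟩ := coeff_rename_ne_zero _ _ _ hm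
  have hw := hf hu
  rw [Finsupp.weight_apply, Finsupp.sum_fintype _ _ (by simp)] at hw
  rw [Finsupp.weight_apply, Finsupp.sum_mapDomain_index (by simp) (by simp [add_smul]),
    Finsupp.sum_fintype _ _ (by simp)]
  have h1 : ∑ i, u i = k := by simpa using hw
  ext <;> simp [Prod.fst_sum, Prod.snd_sum, h1]

theorem eval_logGradient_ne_zero (hk : 1 ≤ k) (hf : f.IsHomogeneous k) {x : Fin (n + 1) → ℂ}
    (hx : eval x f ≠ 0) : (fun i => eval x (logGradient f i)) ≠ 0 := by
  intro h
  have h1 := congrArg (eval x) (sum_logGradient hf)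
  simp only [map_sum, map_mul, map_natCast, congrFun h, Pi.zero_apply,
    Finset.sum_const_zero] at h1
  have : (k : ℂ) ≠ 0 := by exact_mod_cast (by omega : k ≠ 0)
  exact mul_ne_zero this hx h1.symm

/-- The affine bicone over the graph of the logarithmic Gauss map of `f = 1` consists of the points
`((x, z), t ∇ f(x))` with `f x = z ^ k`, where `∇` is the logarithmic gradient. -/
theorem mem_biVanishingIdeal_logGaussGraph_iff (hk : 1 ≤ k) (hf : f.IsHomogeneous k)
    {G : BiRing (n + 1) n} :
    G ∈ biVanishingIdeal (logGaussGraph (f - 1)) ↔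
      ∀ (x : Fin (n + 1) → ℂ) (z t : ℂ), (∀ i, x i ≠ 0) → z ≠ 0 → eval x f = z ^ k → t ≠ 0 →
        eval (Sum.elim (Fin.snoc x z) (t • fun i => eval x (logGradient f i))) G = 0 := by
  have hT := logGradient_isHomogeneous hk hf
  rw [logGaussGraph, biVanishingIdeal_zariskiClosure, mem_biVanishingIdeal_iff,
    logGradient_sub_one]
  constructor
  · intro h x z t hx hz hfx ht
    have hfx0 : eval x f ≠ 0 := by rw [hfx]; exact pow_ne_zero k hz
    have hTx := eval_logGradient_ne_zero hk hf hfx0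
    have hv : (Fin.snoc x z : Fin (n + 1 + 1) → ℂ) ≠ 0 := fun h0 => hz <| by
      simpa using congrFun h0 (Fin.last (n + 1))
    have hTs : (fun i => eval (z⁻¹ • x) (logGradient f i)) =
        (z⁻¹ ^ k) • fun i => eval x (logGradient f i) := by
      ext i
      rw [Pi.smul_apply, smul_eq_mul, eval_smul_of_isHomogeneous (hT i)]
    refine h (Fin.snoc x z) hv (t • fun i => eval x (logGradient f i)) (smul_ne_zero ht hTx) ?_
    have hzx : ∀ i, (z⁻¹ • x) i ≠ 0 := fun i => by
      rw [Pi.smul_apply, smul_eq_mul]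
      exact mul_ne_zero (inv_ne_zero hz) (hx i)
    have hfzx : eval (z⁻¹ • x) (f - 1) = 0 := by
      rw [map_sub, map_one, eval_smul_of_isHomogeneous hf, hfx, ← mul_pow, inv_mul_cancel₀ hz,
        one_pow, sub_self]
    have hTzx : (fun i => eval (z⁻¹ • x) (logGradient f i)) ≠ 0 := by
      rw [hTs]
      exact smul_ne_zero (pow_ne_zero k (inv_ne_zero hz)) hTx
    refine ⟨z⁻¹ • x, ⟨hzx, hfzx⟩, hTzx, Prod.ext ?_ ?_⟩
    · refine (Projectivization.mk_eq_mk_iff' ℂ _ _ _ _).2 ⟨z, ?_⟩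
      ext l
      refine Fin.lastCases ?_ (fun l => ?_) l
      · simp
      · simp [mul_inv_cancel_left₀ hz]
    · refine (Projectivization.mk_eq_mk_iff' ℂ _ _ _ _).2 ⟨t * z ^ k, ?_⟩
      rw [hTs, smul_smul, mul_assoc, ← mul_pow, mul_inv_cancel₀ hz, one_pow, mul_one]
  · rintro h v hv w hw ⟨x, ⟨hx, hfx⟩, hTx, heq⟩
    obtain ⟨s, rfl⟩ := (Projectivization.mk_eq_mk_iff' ℂ _ _ _ _).1 (congrArg Prod.fst heq)
    obtain ⟨t, rfl⟩ := (Projectivization.mk_eq_mk_iff' ℂ _ _ _ _).1 (congrArg Prod.snd heq)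
    have hs : s ≠ 0 := left_ne_zero_of_smul hv
    have ht : t ≠ 0 := left_ne_zero_of_smul hw
    have hfx1 : eval x f = 1 := by simpa [sub_eq_zero] using hfx
    have hv' : s • (Fin.snoc x 1 : Fin (n + 1 + 1) → ℂ) = Fin.snoc (s • x) s := by
      ext l
      refine Fin.lastCases ?_ (fun l => ?_) l <;> simp
    have hw' : (t • fun i => eval x (logGradient f i)) =
        (t * (s ^ k)⁻¹) • fun i => eval (s • x) (logGradient f i) := by
      ext i
      simp only [Pi.smul_apply, smul_eq_mul, eval_smul_of_isHomogeneous (hT i)]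
      field_simp
    rw [hv', hw']
    have hsx : ∀ i, (s • x) i ≠ 0 := fun i => by
      rw [Pi.smul_apply, smul_eq_mul]
      exact mul_ne_zero hs (hx i)
    refine h (s • x) s (t * (s ^ k)⁻¹) hsx hs ?_
      (mul_ne_zero ht (inv_ne_zero (pow_ne_zero k hs)))
    rw [eval_smul_of_isHomogeneous hf, hfx1, mul_one]

theorem eval_polyEquiv {a b : ℕ} (G : BiRing (a + 1) b) (v : Fin (a + 1) → ℂ) (z : ℂ)
    (w : Fin (b + 1) → ℂ) :
    ((polyEquiv a b G).map (eval (Sum.elim v w))).eval z =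
      eval (Sum.elim (Fin.snoc v z) w) G := by
  obtain ⟨P, rfl⟩ := (polyEquiv a b).symm.surjective G
  rw [RingEquiv.apply_symm_apply]
  induction P using Polynomial.induction_on' with
  | add p r hp hr => simp only [map_add, Polynomial.map_add, Polynomial.eval_add, hp, hr]
  | monomial m c =>
    have hX : (polyEquiv a b).symm Polynomial.X = lastVar a b := by
      rw [← polyEquiv_lastVar, RingEquiv.symm_apply_apply]
    rw [← Polynomial.C_mul_X_pow_eq_monomial, map_mul, map_pow, hX, polyEquiv_symm_C, map_mul,
      eval_coneHom]
    simp [lastVar]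

/-- Since `X ^ k - c` is separable, it has `k` distinct roots, too many for `p`. -/
theorem eq_zero_of_eval_roots (hk : 1 ≤ k) {c : ℂ} (hc : c ≠ 0) {p : Polynomial ℂ}
    (hp : p.degree < k) (h : ∀ z, z ^ k = c → p.eval z = 0) : p = 0 := by
  have hsep : (Polynomial.X ^ k - Polynomial.C c).Separable :=
    Polynomial.separable_X_pow_sub_C c (by exact_mod_cast (by omega : k ≠ 0)) hc
  have hcard := Polynomial.card_rootSet_eq_natDegree hsep
    (IsAlgClosed.splits ((Polynomial.X ^ k - Polynomial.C c).map (algebraMap ℂ ℂ)))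
  by_contra hp0
  refine hp0 (Polynomial.eq_zero_of_natDegree_lt_card_of_eval_eq_zero p
    (Subtype.val_injective : Function.Injective
      (Subtype.val : (Polynomial.X ^ k - Polynomial.C c).rootSet ℂ → ℂ)) (fun z => h z ?_) ?_)
  · have hz := (Polynomial.mem_rootSet.1 z.2).2
    simpa [sub_eq_zero] using hz
  · rw [hcard, Polynomial.natDegree_X_pow_sub_C]
    exact (Polynomial.natDegree_lt_iff_degree_lt hp0).2 hp

/-- The variety of critical points of `f = 1` is the hypersurface `z ^ k = f` of the cone over the
graph of the toric polar map. -/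
theorem biVanishingIdeal_logGaussGraph (hk : 1 ≤ k) (hf : f.IsHomogeneous k) (hf0 : f ≠ 0)
    {j : Fin (n + 1)} (hj : logGradient f j ≠ 0) :
    biVanishingIdeal (logGaussGraph (f - 1)) =
      (graphSubvariety (logGradient f) (logGradient_isHomogeneous hk hf) hj).cone.ideal ⊔
        Ideal.span {lastVar n n ^ k - coneHom n n (rename Sum.inl f)} := by
  have hk0 : k ≠ 0 := by omega
  set Γ := graphSubvariety (logGradient f) (logGradient_isHomogeneous hk hf) hj
  have hmon := Polynomial.monic_X_pow_sub_C (rename Sum.inl f : BiRing n n) hk0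
  have hM : polyEquiv n n (lastVar n n ^ k - coneHom n n (rename Sum.inl f)) =
      Polynomial.X ^ k - Polynomial.C (rename Sum.inl f) := by
    rw [map_sub, map_pow, polyEquiv_lastVar, polyEquiv_coneHom]
  have hfe : ∀ (x w : Fin (n + 1) → ℂ),
      eval (Sum.elim x w) (rename Sum.inl f : BiRing n n) = eval x f := fun x w => by
    rw [eval_rename]
    rfl
  apply le_antisymm
  · intro G hG
    rw [mem_biVanishingIdeal_logGaussGraph_iff hk hf] at hG
    set M : Polynomial (BiRing n n) := Polynomial.X ^ k - Polynomial.C (rename Sum.inl f) with hMdef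
    set R := polyEquiv n n G %ₘ M with hR
    have hdec : R + M * (polyEquiv n n G /ₘ M) = polyEquiv n n G :=
      Polynomial.modByMonic_add_div _ _
    have hcoeff : ∀ m, R.coeff m ∈ Γ.ideal := by
      intro m
      rw [mem_graphSubvariety_iff]
      have hprod : f * ∏ i, X i ≠ 0 :=
        mul_ne_zero hf0 (Finset.prod_ne_zero_iff.2 fun i _ => X_ne_zero i)
      refine graphHom_eq_zero hprod fun v t hv ht => ?_
      rw [map_mul, map_prod, mul_ne_zero_iff, Finset.prod_ne_zero_iff] at hv
      simp only [eval_X, Finset.mem_univ, true_implies] at hv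
      set w := t • fun j => eval v (logGradient f j) with hw
      rw [← Polynomial.coeff_map]
      have hdeg : (R.map (eval (Sum.elim v w))).degree < k := by
        refine lt_of_le_of_lt Polynomial.degree_map_le ?_
        have := Polynomial.degree_modByMonic_lt (polyEquiv n n G) hmon
        rwa [Polynomial.degree_X_pow_sub_C (by omega)] at this
      rw [eq_zero_of_eval_roots hk hv.1 hdeg, Polynomial.coeff_zero]
      intro z hz
      have hz0 : z ≠ 0 := by
        rintro rfl
        rw [zero_pow hk0] at hz
        exact hv.1 hz.symm
      have h1 := eval_polyEquiv G v z w
      rw [hG v z t hv.2 hz0 hz.symm ht, ← hdec, Polynomial.map_add, Polynomial.map_mul,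
        Polynomial.eval_add, Polynomial.eval_mul] at h1
      have h2 : (M.map (eval (Sum.elim v w))).eval z = 0 := by
        rw [hMdef]
        simp [hfe, hz]
      rwa [h2, zero_mul, add_zero] at h1
    have hRm : (polyEquiv n n).symm R ∈ Γ.cone.ideal := by
      change _ ∈ Γ.ideal.map (coneHom n n)
      rw [map_coneHom_eq, Ideal.mem_comap, RingEquiv.apply_symm_apply]
      exact Ideal.mem_map_C_iff.2 hcoeff
    have hG' : G = (polyEquiv n n).symm R +
        (lastVar n n ^ k - coneHom n n (rename Sum.inl f)) *
          (polyEquiv n n).symm (polyEquiv n n G /ₘ M) := by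
      apply (polyEquiv n n).injective
      rw [map_add, map_mul, hM, RingEquiv.apply_symm_apply, RingEquiv.apply_symm_apply]
      exact hdec.symm
    rw [hG']
    exact add_mem (Ideal.mem_sup_left hRm) (Ideal.mem_sup_right
      (Ideal.mul_mem_right _ _ (Ideal.mem_span_singleton_self _)))
  · refine sup_le (Ideal.map_le_iff_le_comap.2 fun G hG => ?_)
      ((Ideal.span_singleton_le_iff_mem _).2 ?_)
    · rw [mem_graphSubvariety_iff] at hG
      rw [Ideal.mem_comap, mem_biVanishingIdeal_logGaussGraph_iff hk hf]
      intro x z t hx hz hfx ht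
      rw [eval_coneHom, ← eval_graphHom, hG]
      simp
    · rw [mem_biVanishingIdeal_logGaussGraph_iff hk hf]
      intro x z t hx hz hfx ht
      rw [map_sub, eval_coneHom, hfe, hfx]
      simp [lastVar]

theorem chowClass_logGaussGraph (hk : 1 ≤ k) (hf : f.IsHomogeneous k) (hf0 : f ≠ 0) :
    chowClass (logGaussGraph (f - 1)) =
      (k : ℤ) • embedChow n n (chowClass (graphClosure (logGradient f))) := by
  classical
  obtain ⟨j, hj⟩ := exists_logGradient_ne_zero hk hf hf0
  have hk0 : k ≠ 0 := by omega
  have hT := logGradient_isHomogeneous hk hf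
  have hfΓ : rename Sum.inl f ∉ (graphSubvariety (logGradient f) hT hj).ideal := by
    rw [mem_graphSubvariety_iff]
    intro h
    apply hf0
    refine MvPolynomial.funext fun v => ?_
    have h1 := eval_graphHom (q := logGradient f) (rename Sum.inl f) v 0
    rw [h, eval_rename] at h1
    simpa using h1.symm
  -- by Euler's identity, `f` lies in the ideal generated by the variables
  have hfX : ∀ V : Subvariety (n + 1) n, coneHom n n (rename Sum.inl f) ∉ V.ideal →
      ∃ i : Fin (n + 1), (X (Sum.inl i.castSucc) : BiRing (n + 1) n) ∉ V.ideal := by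
    intro V hV
    by_contra! hX
    apply hV
    have h1 := congrArg (fun p => coneHom n n (rename Sum.inl p)) (sum_logGradient hf)
    simp only [logGradient, map_sum, map_mul, map_natCast, rename_X, coneHom_X_inl] at h1
    have hu : IsUnit (k : BiRing (n + 1) n) := by
      have : (k : ℂ) ≠ 0 := by exact_mod_cast hk0
      simpa using (isUnit_iff_ne_zero.2 this).map (C : ℂ →+* BiRing (n + 1) n)
    rw [← Ideal.unit_mul_mem_iff_mem _ hu, ← h1]
    exact Ideal.sum_mem _ fun i _ => Ideal.mul_mem_right _ _ (hX i)
  have hprin := isPrincipalCycle_sub hk0 (rename_inl_mem_bigrading hf) hfΓ hfX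
    (s := (components_finite (logGaussGraph (f - 1))).toFinset) fun V => by
      rw [Set.Finite.mem_toFinset, ← biVanishingIdeal_logGaussGraph hk hf hf0 hj]
      rfl
  rw [chowClass_graphClosure hT hj, embedChow_mk, ← QuotientAddGroup.mk_zsmul, chowClass]
  rw [QuotientAddGroup.eq_iff_sub_mem]
  have hsingle : (k : ℤ) • embedCycle n n (Finsupp.single (graphSubvariety (logGradient f) hT hj) 1)
      = Finsupp.single (graphSubvariety (logGradient f) hT hj).embed (k : ℤ) := by
    change (k : ℤ) • Finsupp.mapDomain _ _ = _
    rw [Finsupp.mapDomain_single, Finsupp.smul_single, smul_eq_mul, mul_one]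
  rw [hsingle]
  exact AddSubgroup.subset_closure hprin

end AffineHypersurface

end ToricPolar

end

open ToricPolar
theorem proposition3 (n : ℕ) :
    (∀ g : MvPolynomial (Fin (n + 1)) ℂ, Squarefree g → 0 < g.totalDegree →
      criticalVariety (torusZeros g) = logGaussGraph g) ∧
    (∀ (k : ℕ) (f : MvPolynomial (Fin (n + 1)) ℂ), 1 ≤ k → f ≠ 0 → f.IsHomogeneous k →
      criticalVariety (torusZeros (f - 1)) = logGaussGraph (f - 1) ∧
      ∀ d : Fin (n + 1) → ℤ, IsMultidegrees (logGradient f) d →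
        chowClass (criticalVariety (torusZeros (f - 1))) =
          ∑ i : Fin (n + 1), ((k : ℤ) * d i) •
            chowClass (linearProduct (n + 1) n (n - (i : ℕ)) (i : ℕ))) := by
  refine ⟨fun g hg _ => criticalVariety_eq_logGaussGraph hg, fun k f hk hf0 hf => ?_⟩
  have hcrit := criticalVariety_eq_logGaussGraph (squarefree_sub_one hk hf)
  refine ⟨hcrit, fun d hd => ?_⟩
  rw [hcrit, chowClass_logGaussGraph hk hf hf0, hd, map_sum, Finset.smul_sum]
  refine Finset.sum_congr rfl fun i _ => ?_
  rw [map_zsmul, embedChow_chowClass (biVanishingIdeal_linearProduct_succ (Nat.sub_le n i)),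
    mul_smul]
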